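/- Let $(\Omega,\mathcal F,\mathbb P)$ be an atomless probability space and let $L^\infty$ be the set of essentially bounded random variables on it, almost surely equal ones being identified. Let $\mathcal H$ be the set of distortion functions, i.e. increasing (in the non-strict sense) $h:[0,1]\to[0,1]$ with $h(0)=0$, $h(1)=1$. For $h\in\mathcal H$ and $X\in L^\infty$ put $$\rho_h(X)=\int_0^\infty h(\mathbb P(X\ge x))\,dx+\int_{-\infty}^0\bigl(h(\mathbb P(X\ge x))-h(1)\bigr)\,dx ,$$ and $\tilde h(t)=h(1)-h(1-t)$. Call $h$ dually subadditive if $h(x+y)\le h(x)+h(y)$ and $\tilde h(x+y)\ge\tilde h(x)+\tilde h(y)$ for all $x,y\in[0,1]$ with $x+y\le1$. Random variables $X,Y$ are comonotonic (resp. counter-monotonic) if $(X(\omega)-X(\omega'))(Y(\omega)-Y(\omega'))\ge0$ (resp. $\le0$) for $\mathbb P\times\mathbb P$-almost all $(\omega,\omega')$. An allocation of $X\in L^\infty$ is a vector $(X_1,\dots,X_n)\in(L^\infty)^n$ with $\sum_iX_i=X$; it is comonotonic (resp. counter-monotonic) if any two of its components with different indices are. For $h_1,\dots,h_n\in\mathcal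 H$, let $\square_{i}\rho_{h_i}(X)$, $\boxplus_{i}\rho_{h_i}(X)$, $\boxminus_{i}\rho_{h_i}(X)\in[-\infty,\infty)$ be the infimum of $\sum_{i=1}^n\rho_{h_i}(X_i)$ over all allocations, over all comonotonic allocations, and over all counter-monotonic allocations of $X$, respectively. Relations between functionals below are meant to hold at every $X\in L^\infty$. **Theorem.** Let $n\ge1$. For all $h_1,\dots,h_n\in\mathcal H$ with pointwise minimum $h=\min_ih_i$: (i) If $h$ is dually subadditive, then $\boxminus_{i}\rho_{h_i}\ge\boxplus_{i}\rho_{h_i}=\rho_h\ge\square_{i}\rho_{h_i}$. (ii) If $h$ is dually subadditive and $h_j=h$ for some $j$, then $\boxminus_{i}\rho_{h_i}=\boxplus_{i}\rho_{h_i}=\rho_h\ge\square_{i}\rho_{h_i}$. (iii) If $h$ is concave, then $\boxminus_{i}\rho_{h_i}\ge\boxplus_{i}\rho_{h_i}=\rho_h=\square_{i}\rho_{h_i}$. Moreover, if $n\ge2$, then for every $h\in\mathcal H$ the following are equivalent: $h$ is concave; the relation just displayed holds for all $h_1,\dots,h_n\in\mathcal H$ with $\min_ih_i=h$; it holds for $h_1=\dots=h_n=h$.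 (iv) If $n\ge2$, $h\in\mathcal H$, and the relation in (ii) holds for $h_1=\dots=h_n=h$ (in particular, if it holds for all $h_1,\dots,h_n\in\mathcal H$ with $\min_ih_i=h$, or for all such families with $h_j=h$ for some $j$), then $h$ is dually subadditive. -/

import Mathlib

open MeasureTheory Set

noncomputable section

namespace RiskSharing

/-- A measure is atomless if every measurable set of positive measure contains a measurable subset
of strictly smaller positive measure. (This is stronger than `NoAtoms`, which only speaks about
singletons.) -/
def Atomless {Ω : Type*} [MeasurableSpace Ω] (P : Measure Ω) : Prop :=
  ∀ A : Set Ω, MeasurableSet A → 0 < P A →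
    ∃ B : Set Ω, MeasurableSet B ∧ B ⊆ A ∧ 0 < P B ∧ P B < P A

/-- Distortion functions: increasing maps `[0,1] → [0,1]` with `h 0 = 0` and `h 1 = 1`. A function
on `[0,1]` is represented by a function on `ℝ` of which only the values on `[0,1]` matter. -/
structure IsDistortion (h : ℝ → ℝ) : Prop where
  mapsTo : MapsTo h (Icc 0 1) (Icc 0 1)
  mono : MonotoneOn h (Icc 0 1)
  map_zero : h 0 = 0
  map_one : h 1 = 1

/-- The dual of a distortion function. -/
def dual (h : ℝ → ℝ) : ℝ → ℝ := fun t => h 1 - h (1 - t)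

/-- `h` is subadditive on `[0,1]` and its dual is superadditive on `[0,1]`. -/
def DuallySubadditive (h : ℝ → ℝ) : Prop :=
  (∀ x ∈ Icc (0 : ℝ) 1, ∀ y ∈ Icc (0 : ℝ) 1, x + y ≤ 1 → h (x + y) ≤ h x + h y) ∧
  (∀ x ∈ Icc (0 : ℝ) 1, ∀ y ∈ Icc (0 : ℝ) 1, x + y ≤ 1 → dual h x + dual h y ≤ dual h (x + y))

/-- The pointwise minimum of finitely many distortion functions. -/
def minDistortion {n : ℕ} (f : Fin n → ℝ → ℝ) : ℝ → ℝ := fun t => ⨅ i, f i t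

section

variable {Ω : Type*} [MeasurableSpace Ω]

/-- The distortion risk measure `∫ X d(h ∘ P)` (a Choquet integral). -/
def riskMeasure (P : Measure Ω) (h : ℝ → ℝ) (X : Ω → ℝ) : ℝ :=
  (∫ x in Ioi (0 : ℝ), h (P.real {ω | x ≤ X ω})) +
    ∫ x in Iio (0 : ℝ), (h (P.real {ω | x ≤ X ω}) - h 1)

/-- Two random variables are comonotonic. -/
def Comonotonic (P : Measure Ω) (X Y : Ω → ℝ) : Prop :=
  ∀ᵐ p ∂(P.prod P), 0 ≤ (X p.1 - X p.2) * (Y p.1 - Y p.2)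

/-- Two random variables are counter-monotonic. -/
def CounterMonotonic (P : Measure Ω) (X Y : Ω → ℝ) : Prop :=
  ∀ᵐ p ∂(P.prod P), (X p.1 - X p.2) * (Y p.1 - Y p.2) ≤ 0

/-- The allocations of `X` among `n` agents in `L^∞`; random variables that are almost surely equal
are identified, hence the almost sure equality. -/
def allocations (P : Measure Ω) (n : ℕ) (X : Ω → ℝ) : Set (Fin n → Ω → ℝ) :=
  {Y | (∀ i, MemLp (Y i) ⊤ P) ∧ (fun ω => ∑ i, Y i ω) =ᵐ[P] X}

/-- The (pairwise) comonotonic allocations of `X`. -/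
def comonotonicAllocations (P : Measure Ω) (n : ℕ) (X : Ω → ℝ) : Set (Fin n → Ω → ℝ) :=
  {Y | Y ∈ allocations P n X ∧ ∀ i j, i ≠ j → Comonotonic P (Y i) (Y j)}

/-- The (pairwise) counter-monotonic allocations of `X`. -/
def counterMonotonicAllocations (P : Measure Ω) (n : ℕ) (X : Ω → ℝ) : Set (Fin n → Ω → ℝ) :=
  {Y | Y ∈ allocations P n X ∧ ∀ i j, i ≠ j → CounterMonotonic P (Y i) (Y j)}

/-- The infimum of the aggregate risk values `∑ i, ρ i (Y i)` over a set of allocations, as an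
extended real number (it can be `-∞`). -/
def infAggregate {n : ℕ} (ρ : Fin n → (Ω → ℝ) → ℝ) (A : Set (Fin n → Ω → ℝ)) : EReal :=
  ⨅ Y ∈ A, ((∑ i, ρ i (Y i) : ℝ) : EReal)

/-- The unconstrained inf-convolution of the distortion risk measures of `f 0, …, f (n - 1)`. -/
def infConv (P : Measure Ω) {n : ℕ} (f : Fin n → ℝ → ℝ) (X : Ω → ℝ) : EReal :=
  infAggregate (fun i => riskMeasure P (f i)) (allocations P n X)

/-- The comonotonic inf-convolution of the distortion risk measures of `f 0, …, f (n - 1)`. -/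
def comonotonicInfConv (P : Measure Ω) {n : ℕ} (f : Fin n → ℝ → ℝ) (X : Ω → ℝ) : EReal :=
  infAggregate (fun i => riskMeasure P (f i)) (comonotonicAllocations P n X)

/-- The counter-monotonic inf-convolution of the distortion risk measures of
`f 0, …, f (n - 1)`. -/
def counterMonotonicInfConv (P : Measure Ω) {n : ℕ} (f : Fin n → ℝ → ℝ) (X : Ω → ℝ) : EReal :=
  infAggregate (fun i => riskMeasure P (f i)) (counterMonotonicAllocations P n X)

/-- `⊟ ρ_{f i} ≥ ⊞ ρ_{f i} = ρ_h = □ ρ_{f i}` on `L^∞`. -/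
def ConcaveRelation (P : Measure Ω) {n : ℕ} (f : Fin n → ℝ → ℝ) (h : ℝ → ℝ) : Prop :=
  ∀ X : Ω → ℝ, MemLp X ⊤ P →
    comonotonicInfConv P f X ≤ counterMonotonicInfConv P f X ∧
    comonotonicInfConv P f X = (riskMeasure P h X : EReal) ∧
    (riskMeasure P h X : EReal) = infConv P f X

/-- `⊟ ρ_{f i} = ⊞ ρ_{f i} = ρ_h ≥ □ ρ_{f i}` on `L^∞`. -/
def DualRelation (P : Measure Ω) {n : ℕ} (f : Fin n → ℝ → ℝ) (h : ℝ → ℝ) : Prop :=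
  ∀ X : Ω → ℝ, MemLp X ⊤ P →
    counterMonotonicInfConv P f X = comonotonicInfConv P f X ∧
    comonotonicInfConv P f X = (riskMeasure P h X : EReal) ∧
    infConv P f X ≤ (riskMeasure P h X : EReal)

end

end RiskSharing

end

noncomputable section

namespace RiskSharing

/-! ### Events of prescribed probability: Sierpiński's theorem. -/

section Atomless

variable {Ω : Type*} [MeasurableSpace Ω] {P : Measure Ω} [IsFiniteMeasure P]

/-! Everything rests on the inequality `ρ_h (X + Y) ≤ ρ_h X + ρ_h Y` for three classes of pairs:
comonotonic pairs for every distortion `h`, counter-monotonic pairs for dually subadditive `h`, and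
all pairs for concave `h`. Each version extends to finite sums. Since `ρ` is monotone in the
distortion, replacing every `f i` by `h = min f` only lowers the aggregate risk, so each inequality
makes `ρ_h X` a lower bound over the corresponding allocations (`riskMeasure_minDistortion_le_sum`).

For the comonotonic upper bound, `X` is cut into thin layers, and each layer goes to an agent whose
distortion is minimal at the probability of the corresponding upper level set
(`exists_comonotonicAllocation_le`). If one agent has the minimal distortion everywhere, giving that
agent all of `X` is counter-monotonic, whence (ii).

The three inequalities are proved for variables with values in a grid, whose Choquet integral is a
finite sum over upper level sets. Rounding up to mesh `δ` changes `ρ_h` by at most `δ`, by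
monotonicity and translation alone, so `h` need not be continuous. For concave `h` the distorted
probability is submodular and `Y` is added to `X` one layer at a time; for comonotonic pairs the
level sets are nested and the same scheme gives equality at each layer. For counter-monotonic pairs
two level sets are almost surely disjoint or cover the space: subadditivity of `h` handles the first
case, superadditivity of the dual the second, and an induction strips overlapping pairs of layers
(`natChoquet_add_le_of_disjoint_or_cover`).

Conversely, for `n ≥ 2` agents sharing one `h`, the relations in (iii) and (ii) force subadditivity
on all, respectively all counter-monotonic, pairs: the first two agents receive `X` and `Y`. Testing
on indicators of events of prescribed probability, which exist by atomlessness, returns concavity or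
dual subadditivity of `h`. -/

lemma Atomless.exists_subset_measureReal_le_half (hP : Atomless P) {S : Set Ω}
    (hS : MeasurableSet S) (hpos : 0 < P.real S) :
    ∃ B, MeasurableSet B ∧ B ⊆ S ∧ 0 < P.real B ∧ P.real B ≤ P.real S / 2 := by
  obtain ⟨B, hB, hBS, h0, h1⟩ := hP S hS (ENNReal.toReal_pos_iff.1 hpos).1
  have h0' : 0 < P.real B := ENNReal.toReal_pos h0.ne' (by finiteness)
  have h1' : P.real B < P.real S := ENNReal.toReal_strict_mono (by finiteness) h1
  have hd : P.real (S \ B) = P.real S - P.real B := measureReal_sdiff hBS hB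
  rcases le_total (P.real B) (P.real S / 2) with h | h
  · exact ⟨B, hB, hBS, h0', h⟩
  · exact ⟨S \ B, hS.diff hB, sdiff_subset, by linarith, by linarith⟩

lemma Atomless.exists_subset_measureReal_lt (hP : Atomless P) {S : Set Ω}
    (hS : MeasurableSet S) (hpos : 0 < P.real S) {ε : ℝ} (hε : 0 < ε) :
    ∃ B, MeasurableSet B ∧ B ⊆ S ∧ 0 < P.real B ∧ P.real B < ε := by
  have key : ∀ n : ℕ, ∃ B, MeasurableSet B ∧ B ⊆ S ∧ 0 < P.real B ∧
      P.real B ≤ P.real S * (1 / 2) ^ n := by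
    intro n
    induction n with
    | zero => exact ⟨S, hS, Subset.rfl, hpos, by simp⟩
    | succ n ih =>
      obtain ⟨B, hB, hBS, h0, h1⟩ := ih
      obtain ⟨B', hB', hBB, h0', h1'⟩ := hP.exists_subset_measureReal_le_half hB h0
      exact ⟨B', hB', hBB.trans hBS, h0', by rw [pow_succ]; linarith⟩
  obtain ⟨n, hn⟩ := exists_pow_lt_of_lt_one (div_pos hε hpos) (by norm_num : (1 / 2 : ℝ) < 1)
  obtain ⟨B, hB, hBS, h0, h1⟩ := key n
  rw [lt_div_iff₀ hpos] at hn
  exact ⟨B, hB, hBS, h0, by linarith⟩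

/-- One step of a greedy exhaustion: `T` is enlarged by at least half of what is possible. -/
lemma exists_greedy_superset {S T : Set Ω} {c : ℝ} (hT : MeasurableSet T)
    (hTS : T ⊆ S) (hTc : P.real T ≤ c) :
    ∃ T', MeasurableSet T' ∧ T' ⊆ S ∧ P.real T' ≤ c ∧ T ⊆ T' ∧
      ∀ B, MeasurableSet B → B ⊆ S \ T → P.real T + P.real B ≤ c →
        P.real B ≤ 2 * (P.real T' - P.real T) := by
  set V : Set ℝ := {r | ∃ B, MeasurableSet B ∧ B ⊆ S \ T ∧ P.real T + P.real B ≤ c ∧ P.real B = r}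
  have hV0 : (0 : ℝ) ∈ V := ⟨∅, MeasurableSet.empty, empty_subset _, by simpa, by simp⟩
  have hVb : BddAbove V := ⟨c, by
    rintro _ ⟨B, -, -, h, rfl⟩
    linarith [measureReal_nonneg (μ := P) (s := T)]⟩
  obtain ⟨B, hB, hBS, hBc, hBV⟩ : ∃ B, MeasurableSet B ∧ B ⊆ S \ T ∧ P.real T + P.real B ≤ c ∧
      sSup V ≤ 2 * P.real B := by
    by_contra! hcon
    have h1 : sSup V ≤ sSup V / 2 := csSup_le ⟨0, hV0⟩ (by
      rintro _ ⟨B, h1, h2, h3, rfl⟩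
      linarith [hcon B h1 h2 h3])
    have h2 := hcon ∅ MeasurableSet.empty (empty_subset _) (by simpa)
    rw [measureReal_empty] at h2
    linarith
  have hdisj : Disjoint T B := disjoint_left.2 fun ω h h' => (hBS h').2 h
  have hU : P.real (T ∪ B) = P.real T + P.real B := measureReal_union hdisj hB
  refine ⟨T ∪ B, hT.union hB, union_subset hTS (hBS.trans sdiff_subset), by linarith,
    subset_union_left, fun B' h1 h2 h3 => ?_⟩
  have := le_csSup hVb ⟨B', h1, h2, h3, rfl⟩
  linarith

/-- Sierpiński's theorem: an atomless finite measure attains all intermediate values. -/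
theorem Atomless.exists_subset_measureReal_eq (hP : Atomless P) {S : Set Ω}
    (hS : MeasurableSet S) {c : ℝ} (hc0 : 0 ≤ c) (hc : c ≤ P.real S) :
    ∃ T, MeasurableSet T ∧ T ⊆ S ∧ P.real T = c := by
  choose! g hgm hgS hgc hgsub hg using fun (T : Set Ω)
    (h : MeasurableSet T ∧ T ⊆ S ∧ P.real T ≤ c) => exists_greedy_superset h.1 h.2.1 h.2.2
  set T : ℕ → Set Ω := fun n => g^[n] ∅
  have hsucc : ∀ n, T (n + 1) = g (T n) := fun n => Function.iterate_succ_apply' g n ∅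
  have hT : ∀ n, MeasurableSet (T n) ∧ T n ⊆ S ∧ P.real (T n) ≤ c := by
    intro n
    induction n with
    | zero => exact ⟨MeasurableSet.empty, empty_subset _, by simpa [T] using hc0⟩
    | succ n ih =>
      rw [hsucc]
      exact ⟨hgm _ ih, hgS _ ih, hgc _ ih⟩
  have hmono : Monotone T := monotone_nat_of_le_succ fun n => by
    rw [hsucc]; exact hgsub _ (hT n)
  set U := ⋃ n, T n
  have hUm : MeasurableSet U := MeasurableSet.iUnion fun n => (hT n).1
  have hUS : U ⊆ S := iUnion_subset fun n => (hT n).2.1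
  have hlim : Filter.Tendsto (fun n => P.real (T n)) Filter.atTop (nhds (P.real U)) :=
    (ENNReal.tendsto_toReal (by finiteness)).comp (tendsto_measure_iUnion_atTop hmono)
  have hUc : P.real U ≤ c := le_of_tendsto' hlim fun n => (hT n).2.2
  refine ⟨U, hUm, hUS, hUc.antisymm (not_lt.1 fun hlt => ?_)⟩
  have hd : P.real (S \ U) = P.real S - P.real U := measureReal_sdiff hUS hUm
  -- If the limit fell short of `c`, this `B` would have been admissible at every greedy step, so
  -- each step would gain at least `P.real B / 2`, contradicting boundedness.
  obtain ⟨B, hB, hBS, hB0, hB1⟩ := hP.exists_subset_measureReal_lt (hS.diff hUm)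
    (by linarith) (sub_pos.2 hlt)
  have hTU : ∀ n, P.real (T n) ≤ P.real U := fun n => measureReal_mono (subset_iUnion T n)
  have hstep : ∀ n, P.real B ≤ 2 * (P.real (T (n + 1)) - P.real (T n)) := fun n => by
    rw [hsucc]
    exact hg _ (hT n) B hB (hBS.trans (sdiff_subset_sdiff_right (subset_iUnion T n)))
      (by linarith [hTU n])
  have hsum : ∀ n : ℕ, n * P.real B ≤ 2 * P.real (T n) := by
    intro n
    induction n with
    | zero => simp
    | succ n ih => push_cast; linarith [hstep n]
  obtain ⟨n, hn⟩ := exists_nat_gt (2 * c / P.real B)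
  rw [div_lt_iff₀ hB0] at hn
  linarith [hsum n, (hT n).2.2]

end Atomless

/-! ### Concavity from decreasing increments. -/

/-- A monotone function on `[0,1]` with decreasing increments is concave. -/
lemma concaveOn_of_increments_antitone {h : ℝ → ℝ} (hm : MonotoneOn h (Icc 0 1))
    (hi : ∀ x y z, 0 ≤ x → 0 ≤ y → 0 ≤ z → x + y + z ≤ 1 →
      h (x + y + z) + h x ≤ h (x + y) + h (x + z)) :
    ConcaveOn ℝ (Icc 0 1) h := by
  refine concaveOn_of_slope_anti_adjacent (convex_Icc 0 1) ?_
  intro a b c ha hc hab hbc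
  obtain ⟨ha0, ha1⟩ := ha
  obtain ⟨hc0, hc1⟩ := hc
  have hba : 0 < b - a := sub_pos.2 hab
  have hcb : 0 < c - b := sub_pos.2 hbc
  rw [div_le_div_iff₀ hcb hba]
  have hH : h a ≤ h b := hm ⟨ha0, ha1⟩ ⟨by linarith, by linarith⟩ hab.le
  -- Cut `[a, b]` into `N` steps of length `δ` and compare with the increment `Δ` over the last one:
  -- steps further left gain at least `Δ`, full or partial steps to the right of `b` at most `Δ`.
  -- Covering `[b, c]` may need one step too many, which costs the error term; it vanishes as `N →
  -- ∞`. Monotonicity takes the place of continuity in the partial step.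
  have key : ∀ N : ℕ, 0 < N →
      (h c - h b) * (b - a) ≤ (h b - h a) * (c - b) + (h b - h a) * (b - a) / N := by
    intro N hN
    have hN' : (0 : ℝ) < N := Nat.cast_pos.2 hN
    set δ := (b - a) / N with hδ
    have hδ0 : 0 < δ := div_pos hba hN'
    have hNδ : N * δ = b - a := by rw [hδ]; field_simp
    set Δ := h b - h (b - δ) with hΔ
    have hleft : ∀ k : ℕ, k ≤ N → k * Δ ≤ h b - h (b - k * δ) := by
      intro k hk
      induction k with
      | zero => simp
      | succ k ih =>
        have hk' : ((k + 1 : ℕ) : ℝ) * δ ≤ N * δ := by gcongr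
        push_cast at hk' ⊢
        have h1 := ih (by omega)
        have h0 : 0 ≤ (k : ℝ) * δ := by positivity
        have h2 := hi (b - (k + 1) * δ) δ (k * δ) (by linarith) hδ0.le h0 (by linarith)
        have e1 : b - (k + 1) * δ + δ + k * δ = b := by ring
        have e2 : b - (k + 1) * δ + δ = b - k * δ := by ring
        have e3 : b - (k + 1) * δ + k * δ = b - δ := by ring
        rw [e1, e2, e3] at h2
        linarith
    have hright : ∀ k : ℕ, ∀ d, 0 ≤ d → d ≤ k * δ → b + d ≤ 1 → h (b + d) - h b ≤ k * Δ := by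
      intro k
      induction k with
      | zero =>
        intro d hd hd' _
        have : d = 0 := by simp at hd'; linarith
        simp [this]
      | succ k ih =>
        intro d hd hd' hd1
        have hbδ : 0 ≤ b - δ := by
          have : 1 * δ ≤ N * δ := by gcongr; exact_mod_cast hN
          linarith
        have hΔ0 : h (b - δ) ≤ h b :=
          hm ⟨hbδ, by linarith⟩ ⟨by linarith, by linarith⟩ (by linarith)
        push_cast at hd' ⊢
        rcases le_total d δ with hdδ | hdδ
        · have h2 := hi (b - δ) δ d hbδ hδ0.le hd (by linarith)
          have h3 : h (b - δ + d) ≤ h b :=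
            hm ⟨by linarith, by linarith⟩ ⟨by linarith, by linarith⟩ (by linarith)
          have h4 : 0 ≤ (k : ℝ) * Δ := mul_nonneg k.cast_nonneg (by linarith)
          have e1 : b - δ + δ + d = b + d := by ring
          have e2 : b - δ + δ = b := by ring
          rw [e1, e2] at h2
          have h5 := hi (b - δ) d δ hbδ hd hδ0.le (by linarith)
          have e3 : b - δ + d + δ = b + d := by ring
          rw [e3, e2] at h5
          linarith
        · have h1 := ih (d - δ) (by linarith) (by linarith) (by linarith)
          have h2 := hi (b - δ) d δ hbδ hd hδ0.le (by linarith)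
          have e1 : b - δ + d + δ = b + d := by ring
          have e2 : b - δ + d = b + (d - δ) := by ring
          have e3 : b - δ + δ = b := by ring
          rw [e1, e2, e3] at h2
          linarith
    set K := ⌈(c - b) / δ⌉₊
    have hK1 : (c - b) / δ ≤ K := Nat.le_ceil _
    have hK2 : (K : ℝ) < (c - b) / δ + 1 := Nat.ceil_lt_add_one (by positivity)
    rw [div_le_iff₀ hδ0] at hK1
    have h1 := hright K (c - b) hcb.le hK1 (by linarith)
    have h2 := hleft N le_rfl
    rw [hNδ, show b - (b - a) = a by ring] at h2
    rw [show b + (c - b) = c by ring] at h1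
    have hΔ1 : Δ ≤ (h b - h a) / N := by rw [le_div_iff₀ hN']; linarith
    have h3 : h c - h b ≤ ((c - b) / δ + 1) * ((h b - h a) / N) :=
      h1.trans (mul_le_mul hK2.le hΔ1 (by
        have : 0 ≤ Δ := by
          have := hright 1 0 le_rfl (by simpa using hδ0.le) (by linarith)
          simpa using this
        exact this) (by positivity))
    calc (h c - h b) * (b - a) ≤ ((c - b) / δ + 1) * ((h b - h a) / N) * (b - a) := by gcongr
      _ = _ := by rw [hδ]; field_simp
  have hlim : Filter.Tendsto
      (fun N : ℕ => (h b - h a) * (c - b) + (h b - h a) * (b - a) / (N : ℝ)) Filter.atTop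
      (nhds ((h b - h a) * (c - b) + 0)) :=
    tendsto_const_nhds.add (tendsto_const_div_atTop_nhds_zero_nat _)
  rw [add_zero] at hlim
  exact ge_of_tendsto hlim (Filter.eventually_atTop.2 ⟨1, fun N hN => key N hN⟩)

/-! ### Distortion risk measures of bounded variables. -/

section RiskMeasure

variable {Ω : Type*} [MeasurableSpace Ω] {P : Measure Ω} {h f : ℝ → ℝ} {X Y : Ω → ℝ}

lemma riskMeasure_congr (hXY : X =ᵐ[P] Y) : riskMeasure P h X = riskMeasure P h Y := by
  have : ∀ x : ℝ, P.real {ω | x ≤ X ω} = P.real {ω | x ≤ Y ω} := fun x =>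
    measureReal_congr (hXY.mono fun ω hω => by
      change (x ≤ X ω) = (x ≤ Y ω)
      rw [hω])
  simp only [riskMeasure, this]

variable [IsProbabilityMeasure P]

variable (P) in
lemma measureReal_mem_Icc (s : Set Ω) : P.real s ∈ Icc (0 : ℝ) 1 :=
  ⟨measureReal_nonneg, measureReal_le_one⟩

lemma riskMeasure_congr_distortion (hf : EqOn f h (Icc 0 1)) :
    riskMeasure P f X = riskMeasure P h X := by
  have : ∀ s : Set Ω, f (P.real s) = h (P.real s) := fun s => hf (measureReal_mem_Icc P s)
  simp only [riskMeasure, this, hf ⟨zero_le_one, le_rfl⟩]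

lemma IsDistortion.apply_mono (hh : IsDistortion h) {s t : Set Ω} (hst : s ⊆ t) :
    h (P.real s) ≤ h (P.real t) :=
  hh.mono (measureReal_mem_Icc P s) (measureReal_mem_Icc P t) (measureReal_mono hst)

lemma IsDistortion.antitone_tail (hh : IsDistortion h) (X : Ω → ℝ) :
    Antitone fun x => h (P.real {ω | x ≤ X ω}) :=
  fun _ _ hxy => hh.apply_mono fun _ hω => hxy.trans hω

lemma IsDistortion.intervalIntegrable_tail (hh : IsDistortion h) (X : Ω → ℝ) (a b : ℝ) :
    IntervalIntegrable (fun x => h (P.real {ω | x ≤ X ω})) volume a b :=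
  (hh.antitone_tail X).intervalIntegrable

/-- For a random variable with values in `[a, b]`, the two integrals defining the distortion risk
measure combine into one. -/
lemma riskMeasure_eq_intervalIntegral (hh : IsDistortion h) {a b : ℝ} (ha : a ≤ 0) (hb : 0 ≤ b)
    (hX : ∀ ω, X ω ∈ Icc a b) :
    riskMeasure P h X = a + ∫ x in a..b, h (P.real {ω | x ≤ X ω}) := by
  have h1 : ∫ x in Ioi (0 : ℝ), h (P.real {ω | x ≤ X ω}) =
      ∫ x in (0 : ℝ)..b, h (P.real {ω | x ≤ X ω}) := by
    rw [intervalIntegral.integral_of_le hb]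
    refine setIntegral_eq_of_subset_of_forall_sdiff_eq_zero measurableSet_Ioi Ioc_subset_Ioi_self ?_
    rintro x ⟨hx, hx'⟩
    have : {ω | x ≤ X ω} = ∅ := eq_empty_of_forall_notMem fun ω hω =>
      hx' ⟨hx, le_trans hω (hX ω).2⟩
    rw [this, measureReal_empty, hh.map_zero]
  have h2 : ∫ x in Iio (0 : ℝ), (h (P.real {ω | x ≤ X ω}) - h 1) =
      ∫ x in a..(0 : ℝ), (h (P.real {ω | x ≤ X ω}) - h 1) := by
    rw [intervalIntegral.integral_of_le ha, integral_Ioc_eq_integral_Ioo,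
      ← integral_Ico_eq_integral_Ioo]
    refine setIntegral_eq_of_subset_of_forall_sdiff_eq_zero measurableSet_Iio Ico_subset_Iio_self ?_
    rintro x ⟨hx, hx'⟩
    have : {ω | x ≤ X ω} = univ := eq_univ_of_forall fun ω => by
      by_contra hω
      exact hx' ⟨(hX ω).1.trans (not_le.1 hω).le, hx⟩
    rw [this, probReal_univ, sub_self]
  rw [riskMeasure, h1, h2, intervalIntegral.integral_sub (hh.intervalIntegrable_tail X a 0)
    intervalIntegrable_const, ← intervalIntegral.integral_add_adjacent_intervals
    (hh.intervalIntegrable_tail X a 0) (hh.intervalIntegrable_tail X 0 b)]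
  simp [hh.map_one]
  ring

lemma riskMeasure_mono (hh : IsDistortion h) {C : ℝ} (hC : 0 ≤ C) (hX : ∀ ω, X ω ∈ Icc (-C) C)
    (hY : ∀ ω, Y ω ∈ Icc (-C) C) (hXY : ∀ ω, X ω ≤ Y ω) :
    riskMeasure P h X ≤ riskMeasure P h Y := by
  rw [riskMeasure_eq_intervalIntegral hh (by linarith) hC hX,
    riskMeasure_eq_intervalIntegral hh (by linarith) hC hY]
  gcongr
  exact intervalIntegral.integral_mono (by linarith) (hh.intervalIntegrable_tail X _ _)
    (hh.intervalIntegrable_tail Y _ _) fun x =>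
      hh.apply_mono fun ω (hω : x ≤ X ω) => hω.trans (hXY ω)

lemma riskMeasure_mono_distortion (hh : IsDistortion h) (hf : IsDistortion f)
    (hle : ∀ t ∈ Icc (0 : ℝ) 1, h t ≤ f t) {C : ℝ} (hC : 0 ≤ C) (hX : ∀ ω, X ω ∈ Icc (-C) C) :
    riskMeasure P h X ≤ riskMeasure P f X := by
  rw [riskMeasure_eq_intervalIntegral hh (by linarith) hC hX,
    riskMeasure_eq_intervalIntegral hf (by linarith) hC hX]
  gcongr
  exact intervalIntegral.integral_mono (by linarith) (hh.intervalIntegrable_tail X _ _)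
    (hf.intervalIntegrable_tail X _ _) fun x => hle _ (measureReal_mem_Icc P _)

lemma riskMeasure_add_const (hh : IsDistortion h) {C d : ℝ} (hC : 0 ≤ C) (hd : 0 ≤ d)
    (hX : ∀ ω, X ω ∈ Icc (-C) C) :
    riskMeasure P h (fun ω => X ω + d) = riskMeasure P h X + d := by
  have hb : ∀ ω, X ω + d ∈ Icc (-C) (C + d) := fun ω =>
    ⟨by linarith [(hX ω).1], by linarith [(hX ω).2]⟩
  -- These bounds are the translate by `-d` of those in `hb`, so that a change of variables matches
  -- the two integrals.
  have hb' : ∀ ω, X ω ∈ Icc (-C - d) (C + d - d) := fun ω =>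
    ⟨by linarith [(hX ω).1], by linarith [(hX ω).2]⟩
  rw [riskMeasure_eq_intervalIntegral hh (by linarith) (by linarith) hb,
    riskMeasure_eq_intervalIntegral hh (by linarith) (by linarith) hb',
    ← intervalIntegral.integral_comp_sub_right (fun x => h (P.real {ω | x ≤ X ω}))]
  simp only [sub_le_iff_le_add]
  ring

/-- The Choquet integral, with respect to the set function `v`, of a random variable with values
in `{0, …, N}`. -/
def natChoquet (v : Set Ω → ℝ) (N : ℕ) (Z : Ω → ℕ) : ℝ :=
  ∑ k ∈ Finset.range N, v {ω | k + 1 ≤ Z ω}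

variable (P h) in
/-- The distorted probability. -/
def distorted (s : Set Ω) : ℝ := h (P.real s)

/-- The level set at `x` is constant for `x` in each interval `(a + δ k, a + δ (k + 1)]`, so the
integral is a sum of terms of width `δ`. The sign conditions place `0` inside the range of
integration. -/
lemma riskMeasure_affine_nat (hh : IsDistortion h) {N : ℕ} {Z : Ω → ℕ} (hZ : ∀ ω, Z ω ≤ N)
    {a δ : ℝ} (hδ : 0 < δ) (ha : a ≤ 0) (hb : 0 ≤ a + δ * N) :
    riskMeasure P h (fun ω => a + δ * Z ω) = a + δ * natChoquet (distorted P h) N Z := by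
  have hX : ∀ ω, a + δ * Z ω ∈ Icc a (a + δ * N) := fun ω => by
    have : (Z ω : ℝ) ≤ N := by exact_mod_cast hZ ω
    exact ⟨le_add_of_nonneg_right (by positivity), by gcongr⟩
  rw [riskMeasure_eq_intervalIntegral hh ha hb hX]
  congr 1
  have hsum := intervalIntegral.sum_integral_adjacent_intervals (μ := volume)
    (f := fun x => h (P.real {ω | x ≤ a + δ * Z ω})) (a := fun k : ℕ => a + δ * k) (n := N)
    (fun k _ => hh.intervalIntegrable_tail _ _ _)
  simp only [Nat.cast_zero, mul_zero, add_zero] at hsum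
  rw [← hsum, natChoquet, Finset.mul_sum]
  refine Finset.sum_congr rfl fun k _ => ?_
  have hk : a + δ * k ≤ a + δ * (k + 1 : ℕ) := by push_cast; linarith
  rw [intervalIntegral.integral_of_le hk,
    setIntegral_congr_fun (g := fun _ => distorted P h {ω | k + 1 ≤ Z ω}) measurableSet_Ioc]
  · have : a + δ * (k + 1 : ℕ) - (a + δ * k) = δ := by push_cast; ring
    rw [setIntegral_const, Real.volume_real_Ioc_of_le hk, this, smul_eq_mul]
  · rintro x ⟨hx1, hx2⟩
    have : {ω | x ≤ a + δ * Z ω} = {ω | k + 1 ≤ Z ω} := by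
      ext ω
      simp only [mem_ofPred_eq]
      constructor
      · intro hω
        have : δ * k < δ * Z ω := by linarith
        exact_mod_cast lt_of_mul_lt_mul_left this hδ.le
      · intro hω
        refine hx2.trans ?_
        gcongr
    simp only [this, distorted]

end RiskMeasure

/-! ### Discrete Choquet integrals of general set functions. -/

section NatChoquet

variable {Ω : Type*} {v : Set Ω → ℝ} {N M : ℕ} {X Y Z : Ω → ℕ}

lemma natChoquet_eq_of_le (hv : v ∅ = 0) (hZ : ∀ ω, Z ω ≤ N) (hNM : N ≤ M) :
    natChoquet v M Z = natChoquet v N Z := by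
  refine (Finset.sum_subset (by simpa using hNM) fun k _ hk => ?_).symm
  have : {ω | k + 1 ≤ Z ω} = ∅ := eq_empty_of_forall_notMem fun ω (hω : k + 1 ≤ Z ω) => by
    have := hZ ω
    simp only [Finset.mem_range] at hk
    omega
  rw [this, hv]

lemma sum_range_succ_remove (a : ℕ → ℝ) {p N : ℕ} (hp : p ≤ N) :
    ∑ k ∈ Finset.range (N + 1), a k =
      ∑ k ∈ Finset.range N, a (if k < p then k else k + 1) + a p := by
  induction N with
  | zero => simp [Nat.le_zero.1 hp]
  | succ N ih =>
    rw [Finset.sum_range_succ]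
    rcases hp.lt_or_eq with h | rfl
    · rw [ih (by omega), Finset.sum_range_succ _ N, if_neg (by omega)]
      ring
    · congr 1
      refine Finset.sum_congr rfl fun k hk => ?_
      rw [if_pos (Finset.mem_range.1 hk)]

/-- The variable `Z` with its layer `{p < Z}` removed. -/
def removeLayer (p : ℕ) (Z : Ω → ℕ) (ω : Ω) : ℕ := if Z ω ≤ p then Z ω else Z ω - 1

lemma succ_le_removeLayer (p k : ℕ) (ω : Ω) :
    k + 1 ≤ removeLayer p Z ω ↔ (if k < p then k else k + 1) + 1 ≤ Z ω := by
  unfold removeLayer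
  split_ifs <;> omega

lemma natChoquet_removeLayer {p : ℕ} (hp : p ≤ N) :
    natChoquet v (N + 1) Z = natChoquet v N (removeLayer p Z) + v {ω | p + 1 ≤ Z ω} := by
  simp only [natChoquet, succ_le_removeLayer]
  exact sum_range_succ_remove (fun k => v {ω | k + 1 ≤ Z ω}) hp

/-- Adding a layer to `Z` when `v` is submodular on the relevant sets. -/
lemma natChoquet_add_indicator_le (hv : v ∅ = 0) (hZ : ∀ ω, Z ω ≤ N) {A : Set Ω}
    (hA : ∀ k, v ({ω | k + 1 ≤ Z ω} ∪ ({ω | k ≤ Z ω} ∩ A)) + v ({ω | k + 1 ≤ Z ω} ∩ A) ≤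
      v {ω | k + 1 ≤ Z ω} + v ({ω | k ≤ Z ω} ∩ A)) :
    natChoquet v (N + 1) (fun ω => Z ω + A.indicator 1 ω) ≤ natChoquet v N Z + v A := by
  have hset : ∀ k, {ω | k + 1 ≤ Z ω + A.indicator 1 ω} =
      {ω | k + 1 ≤ Z ω} ∪ ({ω | k ≤ Z ω} ∩ A) := fun k => by
    ext ω
    by_cases hω : ω ∈ A <;> simp [hω]
    omega
  -- Submodularity bounds the new level `k` by the old one plus `v ({k ≤ Z} ∩ A) - v ({k + 1 ≤ Z} ∩
  -- A)`; these corrections telescope to `v A - v ∅`.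
  have htel := Finset.sum_range_sub (fun k => v ({ω | k ≤ Z ω} ∩ A)) (N + 1)
  have h0 : {ω | 0 ≤ Z ω} ∩ A = A := by simp
  have hN : {ω | N + 1 ≤ Z ω} ∩ A = ∅ := eq_empty_of_forall_notMem fun ω hω =>
    absurd (hZ ω) (not_le.2 hω.1)
  simp only [h0, hN, hv] at htel
  rw [← natChoquet_eq_of_le hv hZ N.le_succ]
  have : natChoquet v (N + 1) (fun ω => Z ω + A.indicator 1 ω) ≤
      ∑ k ∈ Finset.range (N + 1), (v {ω | k + 1 ≤ Z ω} -
        (v ({ω | k + 1 ≤ Z ω} ∩ A) - v ({ω | k ≤ Z ω} ∩ A))) :=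
    Finset.sum_le_sum fun k _ => by rw [hset]; linarith [hA k]
  rw [Finset.sum_sub_distrib, htel] at this
  simpa [natChoquet] using this

/-- Subadditivity of the Choquet integral, layer by layer. -/
lemma natChoquet_add_le_of_layers (hv : v ∅ = 0) (hX : ∀ ω, X ω ≤ N) (hY : ∀ ω, Y ω ≤ M)
    (hXY : ∀ m k, v ({ω | k + 1 ≤ X ω + min (Y ω) m} ∪
        ({ω | k ≤ X ω + min (Y ω) m} ∩ {ω | m + 1 ≤ Y ω})) +
          v ({ω | k + 1 ≤ X ω + min (Y ω) m} ∩ {ω | m + 1 ≤ Y ω}) ≤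
      v {ω | k + 1 ≤ X ω + min (Y ω) m} +
        v ({ω | k ≤ X ω + min (Y ω) m} ∩ {ω | m + 1 ≤ Y ω})) :
    natChoquet v (N + M) (fun ω => X ω + Y ω) ≤ natChoquet v N X + natChoquet v M Y := by
  have key : ∀ m, natChoquet v (N + m) (fun ω => X ω + min (Y ω) m) ≤
      natChoquet v N X + ∑ k ∈ Finset.range m, v {ω | k + 1 ≤ Y ω} := by
    intro m
    induction m with
    | zero => simp
    | succ m ih =>
      have hb : ∀ ω, X ω + min (Y ω) m ≤ N + m := fun ω =>
        add_le_add (hX ω) (min_le_right _ _)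
      have h1 := natChoquet_add_indicator_le hv hb (hXY m)
      have h2 : (fun ω => X ω + min (Y ω) (m + 1)) =
          fun ω => X ω + min (Y ω) m + {ω | m + 1 ≤ Y ω}.indicator 1 ω := by
        funext ω
        simp only [indicator_apply, mem_ofPred_eq, Pi.one_apply]
        split_ifs <;> omega
      rw [← h2] at h1
      rw [Finset.sum_range_succ, ← add_assoc N]
      linarith
  simpa [natChoquet, hY] using key M

end NatChoquet

/-! ### Subadditivity for grid-valued variables. -/

section Distorted

variable {Ω : Type*} [MeasurableSpace Ω] {P : Measure Ω} {h : ℝ → ℝ} {s t : Set Ω}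
  {N M : ℕ} {X Y Z : Ω → ℕ}

lemma measureReal_congr_of_ae_iff (hst : ∀ᵐ ω ∂P, ω ∈ s ↔ ω ∈ t) : P.real s = P.real t :=
  measureReal_congr (Filter.eventuallyEq_set.2 hst)

lemma distorted_congr (hst : ∀ᵐ ω ∂P, ω ∈ s ↔ ω ∈ t) : distorted P h s = distorted P h t := by
  rw [distorted, distorted, measureReal_congr_of_ae_iff hst]

lemma IsDistortion.distorted_empty (hh : IsDistortion h) : distorted P h ∅ = 0 := by
  simp [distorted, hh.map_zero]

/-- Subadditivity of the discrete Choquet integral for comonotonic variables. -/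
lemma natChoquet_add_le_of_nested (hh : IsDistortion h)
    (hXY : ∀ j k, (∀ᵐ ω ∂P, j ≤ X ω → k ≤ Y ω) ∨ ∀ᵐ ω ∂P, k ≤ Y ω → j ≤ X ω)
    (hX : ∀ ω, X ω ≤ N) (hY : ∀ ω, Y ω ≤ M) :
    natChoquet (distorted P h) (N + M) (fun ω => X ω + Y ω) ≤
      natChoquet (distorted P h) N X + natChoquet (distorted P h) M Y := by
  refine natChoquet_add_le_of_layers hh.distorted_empty hX hY fun m k => le_of_eq ?_
  have hAS (H : ∀ᵐ ω ∂P, m + 1 ≤ Y ω → k + 1 ≤ X ω + min (Y ω) m) :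
      distorted P h ({ω | k + 1 ≤ X ω + min (Y ω) m} ∪
          ({ω | k ≤ X ω + min (Y ω) m} ∩ {ω | m + 1 ≤ Y ω})) +
        distorted P h ({ω | k + 1 ≤ X ω + min (Y ω) m} ∩ {ω | m + 1 ≤ Y ω}) =
      distorted P h {ω | k + 1 ≤ X ω + min (Y ω) m} +
        distorted P h ({ω | k ≤ X ω + min (Y ω) m} ∩ {ω | m + 1 ≤ Y ω}) := by
    congr 1 <;> refine distorted_congr (H.mono fun ω hω => ?_) <;>
      simp only [mem_union, mem_inter_iff, mem_ofPred_eq] <;> omega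
  by_cases hk : k + 1 ≤ m
  · exact hAS (ae_of_all _ fun ω => by omega)
  -- Here `m ≤ k`, so the subtraction is genuine. On `{m + 1 ≤ Y}` the truncated `Y` equals `m`, so
  -- lying in the level set means `k + 1 - m ≤ X`. Nestedness thus makes one of the level set and
  -- the new layer contain the other, and submodularity is an equality.
  rcases hXY (k + 1 - m) (m + 1) with H | H
  · rw [add_comm (distorted P h {ω | k + 1 ≤ X ω + min (Y ω) m})]
    congr 1 <;> refine distorted_congr (H.mono fun ω hω => ?_) <;>
      simp only [mem_union, mem_inter_iff, mem_ofPred_eq] <;> omega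
  · exact hAS (H.mono fun ω hω => by omega)

variable [IsProbabilityMeasure P]

lemma IsDistortion.distorted_of_ae (hh : IsDistortion h) (hs : ∀ᵐ ω ∂P, ω ∈ s) :
    distorted P h s = 1 := by
  rw [distorted_congr (t := univ) (hs.mono fun ω hω => by simp [hω])]
  simp [distorted, hh.map_one]

/-- `P.real s` and `P.real t` lie between the probabilities of `s ∩ t` and `s ∪ t` and have the same
sum, so they are convex combinations of these with interchanged weights. Adding the two concavity
inequalities gives submodularity. -/
lemma distorted_union_add_inter_le (hh : ConcaveOn ℝ (Icc 0 1) h) (hs : MeasurableSet s) :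
    distorted P h (s ∪ t) + distorted P h (s ∩ t) ≤ distorted P h s + distorted P h t := by
  have hadd : P.real (s ∪ t) + P.real (s ∩ t) = P.real s + P.real t :=
    measureReal_union_add_inter' hs
  have hps : P.real (s ∩ t) ≤ P.real s := measureReal_mono inter_subset_left
  have hpt : P.real (s ∩ t) ≤ P.real t := measureReal_mono inter_subset_right
  have hp := measureReal_mem_Icc P (s ∩ t)
  have hq := measureReal_mem_Icc P (s ∪ t)
  unfold distorted
  generalize P.real (s ∪ t) = q at *
  generalize P.real (s ∩ t) = p at *
  generalize P.real s = x at *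
  generalize P.real t = y at *
  obtain rfl : y = q + p - x := by linarith
  rcases (show p ≤ q by linarith).eq_or_lt with rfl | hpq
  · obtain rfl : x = p := by linarith
    simp
  have hd : 0 < q - p := sub_pos.2 hpq
  have h1 := hh.2 hp hq
    (div_nonneg (show 0 ≤ q - x by linarith) hd.le) (div_nonneg (show 0 ≤ x - p by linarith) hd.le)
    (by field_simp; ring)
  have h2 := hh.2 hp hq
    (div_nonneg (show 0 ≤ x - p by linarith) hd.le) (div_nonneg (show 0 ≤ q - x by linarith) hd.le)
    (by field_simp; ring)
  simp only [smul_eq_mul] at h1 h2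
  rw [show (q - x) / (q - p) * p + (x - p) / (q - p) * q = x by field_simp; ring] at h1
  rw [show (x - p) / (q - p) * p + (q - x) / (q - p) * q = q + p - x by field_simp; ring] at h2
  have h3 : (q - x) / (q - p) + (x - p) / (q - p) = 1 := by field_simp; ring
  linear_combination h1 + h2 - (h p + h q) * h3

/-- Subadditivity of the discrete Choquet integral for concave distortions. -/
lemma natChoquet_add_le_of_concaveOn (hh : IsDistortion h) (hc : ConcaveOn ℝ (Icc 0 1) h)
    (hXm : Measurable X) (hYm : Measurable Y) (hX : ∀ ω, X ω ≤ N) (hY : ∀ ω, Y ω ≤ M) :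
    natChoquet (distorted P h) (N + M) (fun ω => X ω + Y ω) ≤
      natChoquet (distorted P h) N X + natChoquet (distorted P h) M Y := by
  refine natChoquet_add_le_of_layers hh.distorted_empty hX hY fun m k => ?_
  have h1 : MeasurableSet {ω | k + 1 ≤ X ω + min (Y ω) m} :=
    measurableSet_le measurable_const (hXm.add (hYm.min measurable_const))
  have h2 := distorted_union_add_inter_le (P := P)
    (t := {ω | k ≤ X ω + min (Y ω) m} ∩ {ω | m + 1 ≤ Y ω}) hc h1
  have h3 : {ω | k + 1 ≤ X ω + min (Y ω) m} ∩
      ({ω | k ≤ X ω + min (Y ω) m} ∩ {ω | m + 1 ≤ Y ω}) =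
      {ω | k + 1 ≤ X ω + min (Y ω) m} ∩ {ω | m + 1 ≤ Y ω} := by
    rw [← inter_assoc]
    congr 1
    exact inter_eq_left.2 fun ω (hω : k + 1 ≤ _) => (Nat.le_succ k).trans hω
  rwa [h3] at h2

lemma distorted_union_le_of_disjoint (hd : DuallySubadditive h) (hs : MeasurableSet s)
    (hst : ∀ᵐ ω ∂P, ¬(ω ∈ s ∧ ω ∈ t)) :
    distorted P h (s ∪ t) ≤ distorted P h s + distorted P h t := by
  have hadd : P.real (s ∪ t) + P.real (s ∩ t) = P.real s + P.real t :=
    measureReal_union_add_inter' hs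
  have h0 : P.real (s ∩ t) = 0 := by
    rw [measureReal_congr_of_ae_iff (t := ∅) (hst.mono fun ω hω => by simpa using hω),
      measureReal_empty]
  have h1 := (measureReal_mem_Icc P (s ∪ t)).2
  have e : P.real (s ∪ t) = P.real s + P.real t := by linarith
  rw [e] at h1
  rw [distorted, e]
  exact hd.1 _ (measureReal_mem_Icc P s) _ (measureReal_mem_Icc P t) h1

/-- The complements of `s` and `t` are almost surely disjoint; this is superadditivity of the dual
at their probabilities. -/
lemma distorted_inter_add_one_le_of_cover (hh : IsDistortion h) (hd : DuallySubadditive h)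
    (hs : MeasurableSet s) (hst : ∀ᵐ ω ∂P, ω ∈ s ∨ ω ∈ t) :
    distorted P h (s ∩ t) + 1 ≤ distorted P h s + distorted P h t := by
  have hadd : P.real (s ∪ t) + P.real (s ∩ t) = P.real s + P.real t :=
    measureReal_union_add_inter' hs
  have h1 : P.real (s ∪ t) = 1 := by
    rw [measureReal_congr_of_ae_iff (t := univ) (hst.mono fun ω hω => by simpa using hω),
      probReal_univ]
  have hx := measureReal_mem_Icc P s
  have hy := measureReal_mem_Icc P t
  have hp := measureReal_mem_Icc P (s ∩ t)
  have := hd.2 (1 - P.real s) ⟨by linarith [hx.2], by linarith [hx.1]⟩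
    (1 - P.real t) ⟨by linarith [hy.2], by linarith [hy.1]⟩ (by linarith [hp.1])
  have e : 1 - (1 - P.real s + (1 - P.real t)) = P.real (s ∩ t) := by linarith
  simp only [dual, sub_sub_cancel, e, hh.map_one] at this
  unfold distorted
  linarith

lemma exists_last_of_not {Q : ℕ → Prop} {N : ℕ} (h0 : Q 0) (hN : ¬Q N) :
    ∃ p < N, Q p ∧ ¬Q (p + 1) := by
  induction N with
  | zero => exact absurd h0 hN
  | succ N ih =>
    by_cases hQ : Q N
    · exact ⟨N, N.lt_succ_self, hQ, hN⟩
    · obtain ⟨p, hp, h⟩ := ih hQ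
      exact ⟨p, hp.trans N.lt_succ_self, h⟩

lemma measurable_removeLayer {p : ℕ} (hZ : Measurable Z) : Measurable (removeLayer p Z) :=
  (measurable_of_countable fun n : ℕ => if n ≤ p then n else n - 1).comp hZ

/-- Removing one overlapping pair of layers from counter-monotonic variables. -/
lemma natChoquet_add_le_removeLayer (hh : IsDistortion h) (hd : DuallySubadditive h) {p q : ℕ}
    (hXm : Measurable X) (hYm : Measurable Y)
    (hX : ∀ ω, X ω ≤ N + 1) (hY : ∀ ω, Y ω ≤ M + 1) (hp : p ≤ N) (hq : q ≤ M)
    (hcover : ∀ᵐ ω ∂P, p + 1 ≤ X ω ∨ q + 1 ≤ Y ω)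
    (hX' : ∀ᵐ ω ∂P, ¬(p + 2 ≤ X ω ∧ q + 1 ≤ Y ω))
    (hY' : ∀ᵐ ω ∂P, ¬(p + 1 ≤ X ω ∧ q + 2 ≤ Y ω)) :
    natChoquet (distorted P h) (N + 1 + (M + 1)) (fun ω => X ω + Y ω) ≤
      natChoquet (distorted P h) (N + M) (fun ω => removeLayer p X ω + removeLayer q Y ω) +
        distorted P h {ω | p + 1 ≤ X ω} + distorted P h {ω | q + 1 ≤ Y ω} := by
  set v := distorted P h
  set W : Ω → ℕ := fun ω => removeLayer p X ω + removeLayer q Y ω with hW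
  have hWb : ∀ ω, W ω ≤ N + M := fun ω => by
    have := hX ω
    have := hY ω
    simp only [hW, removeLayer]
    split_ifs <;> omega
  have hWm : Measurable W := (measurable_removeLayer hXm).add (measurable_removeLayer hYm)
  set E : Set Ω := {ω | p + 1 ≤ X ω} ∩ {ω | q + 1 ≤ Y ω}
  have hE : v E + 1 ≤ v {ω | p + 1 ≤ X ω} + v {ω | q + 1 ≤ Y ω} :=
    distorted_inter_add_one_le_of_cover hh hd (measurableSet_le measurable_const hXm) hcover
  have hone : v {ω | 0 + 1 ≤ X ω + Y ω} = 1 := hh.distorted_of_ae (by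
    filter_upwards [hcover] with ω hω
    omega)
  -- Almost surely `X = p + 1`, `Y = q + 1` and `W = p + q` on `E`, while `X + Y = W + 1` off `E`
  -- and `X + Y = W + 2` on `E`. Hence only the level `k = p + q` sees `E`, as a set disjoint from
  -- `{k + 1 ≤ W}`.
  have hstep : ∀ k, v {ω | k + 1 + 1 ≤ X ω + Y ω} ≤
      v {ω | k + 1 ≤ W ω} + if k = p + q then v E else 0 := by
    intro k
    split_ifs with hk
    · refine le_trans (le_of_eq (distorted_congr ?_))
        (distorted_union_le_of_disjoint hd (measurableSet_le measurable_const hWm) ?_)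
      · filter_upwards [hcover, hX', hY'] with ω h1 h2 h3
        simp only [hW, E, removeLayer, mem_union, mem_inter_iff, mem_ofPred_eq]
        split_ifs <;> omega
      · filter_upwards [hcover, hX', hY'] with ω h1 h2 h3
        simp only [hW, E, removeLayer, mem_inter_iff, mem_ofPred_eq]
        split_ifs <;> omega
    · rw [add_zero]
      refine le_of_eq (distorted_congr ?_)
      filter_upwards [hcover, hX', hY'] with ω h1 h2 h3
      simp only [hW, removeLayer]
      split_ifs <;> omega
  have hN : N + 1 + (M + 1) = N + M + 1 + 1 := by ring
  rw [hN, ← natChoquet_eq_of_le hh.distorted_empty hWb (N + M).le_succ]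
  have hsum : natChoquet v (N + M + 1 + 1) (fun ω => X ω + Y ω) ≤
      ∑ k ∈ Finset.range (N + M + 1), (v {ω | k + 1 ≤ W ω} + if k = p + q then v E else 0) + 1 := by
    rw [natChoquet, Finset.sum_range_succ', hone]
    gcongr with k
    exact hstep k
  rw [Finset.sum_add_distrib, Finset.sum_ite_eq' (Finset.range (N + M + 1)),
    if_pos (Finset.mem_range.2 (by omega))] at hsum
  unfold natChoquet at hsum ⊢
  linarith

/-- Subadditivity of the discrete Choquet integral for counter-monotonic variables and dually
subadditive distortions. -/
lemma natChoquet_add_le_of_disjoint_or_cover (hh : IsDistortion h) (hd : DuallySubadditive h)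
    (hXm : Measurable X) (hYm : Measurable Y) (hX : ∀ ω, X ω ≤ N) (hY : ∀ ω, Y ω ≤ M)
    (hXY : ∀ j k, (∀ᵐ ω ∂P, ¬(j ≤ X ω ∧ k ≤ Y ω)) ∨ ∀ᵐ ω ∂P, j ≤ X ω ∨ k ≤ Y ω) :
    natChoquet (distorted P h) (N + M) (fun ω => X ω + Y ω) ≤
      natChoquet (distorted P h) N X + natChoquet (distorted P h) M Y := by
  induction N generalizing M X Y with
  | zero =>
    have h0 : ∀ ω, X ω = 0 := fun ω => Nat.le_zero.1 (hX ω)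
    simp [h0, natChoquet]
  | succ N ih =>
    -- When the supports are disjoint, each level set of the sum is the disjoint union of those of
    -- `X` and `Y`.
    by_cases hdis : ∀ᵐ ω ∂P, ¬(1 ≤ X ω ∧ 1 ≤ Y ω)
    · rw [← natChoquet_eq_of_le hh.distorted_empty hX (Nat.le_add_right (N + 1) M),
        ← natChoquet_eq_of_le hh.distorted_empty hY (Nat.le_add_left M (N + 1)), natChoquet,
        natChoquet, natChoquet, ← Finset.sum_add_distrib]
      refine Finset.sum_le_sum fun k _ => le_trans (le_of_eq (distorted_congr ?_))
        (distorted_union_le_of_disjoint hd (measurableSet_le measurable_const hXm) ?_)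
      · filter_upwards [hdis] with ω hω
        simp only [mem_union, mem_ofPred_eq]
        omega
      · filter_upwards [hdis] with ω hω
        omega
    -- Take the highest layer `p` of `X` that meets the support of `Y`, then the highest layer `q`
    -- of `Y` that meets it. These two are not disjoint, so they cover the space, and maximality
    -- makes the next layer of either one disjoint from the other.
    · obtain ⟨p, hpN, hp, hp'⟩ := exists_last_of_not (N := N + 1)
        (Q := fun p => ¬∀ᵐ ω ∂P, ¬(p + 1 ≤ X ω ∧ 1 ≤ Y ω)) hdis
        (not_not.2 (ae_of_all _ fun ω => by have := hX ω; omega))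
      obtain ⟨q, hqM, hq, hq'⟩ := exists_last_of_not (N := M)
        (Q := fun q => ¬∀ᵐ ω ∂P, ¬(p + 1 ≤ X ω ∧ q + 1 ≤ Y ω)) hp
        (not_not.2 (ae_of_all _ fun ω => by have := hY ω; omega))
      rw [not_not] at hp' hq'
      have hcover := (hXY (p + 1) (q + 1)).resolve_left hq
      obtain ⟨M, rfl⟩ : ∃ M', M = M' + 1 := ⟨M - 1, by omega⟩
      have hp'' : ∀ᵐ ω ∂P, ¬(p + 2 ≤ X ω ∧ q + 1 ≤ Y ω) := by
        filter_upwards [hp'] with ω hω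
        omega
      have h1 := natChoquet_add_le_removeLayer hh hd hXm hYm hX hY (by omega) (by omega)
        hcover hp'' hq'
      have h2 := ih (X := removeLayer p X) (Y := removeLayer q Y) (M := M)
        (measurable_removeLayer hXm) (measurable_removeLayer hYm)
        (fun ω => by have := hX ω; unfold removeLayer; split_ifs <;> omega)
        (fun ω => by have := hY ω; unfold removeLayer; split_ifs <;> omega) (by
          rintro (_ | j) k
          · exact Or.inr (ae_of_all _ fun ω => Or.inl (Nat.zero_le _))
          rcases k with _ | k
          · exact Or.inr (ae_of_all _ fun ω => Or.inr (Nat.zero_le _))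
          -- The positive level sets left after the removal are among the original ones, so the
          -- dichotomy is inherited.
          simp only [succ_le_removeLayer]
          exact hXY _ _)
      rw [natChoquet_removeLayer (Z := X) (p := p) (by omega),
        natChoquet_removeLayer (Z := Y) (p := q) (by omega)]
      linarith

end Distorted

/-! ### From grid-valued to essentially bounded variables. -/

section Transfer

variable {Ω : Type*} [MeasurableSpace Ω] {P : Measure Ω} {h f : ℝ → ℝ} {X Y : Ω → ℝ}

section Approximation

/-- Essentially bounded variables are almost surely equal to measurable bounded ones. -/
lemma exists_measurable_bounded (hX : MemLp X ⊤ P) :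
    ∃ X' : Ω → ℝ, Measurable X' ∧ X =ᵐ[P] X' ∧ ∃ C, 0 < C ∧ ∀ ω, X' ω ∈ Icc (-C) C := by
  have hb : ∀ᵐ ω ∂P, |X ω| ≤ (eLpNorm X ⊤ P).toReal := by
    filter_upwards [ae_le_eLpNormEssSup (f := X) (μ := P)] with ω hω
    rw [← eLpNorm_exponent_top] at hω
    simpa using ENNReal.toReal_mono hX.2.ne hω
  set C := (eLpNorm X ⊤ P).toReal + 1
  have hC : 0 < C := by positivity
  refine ⟨fun ω => max (-C) (min C (hX.1.mk X ω)),
    measurable_const.max (measurable_const.min hX.1.stronglyMeasurable_mk.measurable), ?_,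
    C, hC, fun ω => ⟨le_max_left _ _, max_le (by linarith) (min_le_left _ _)⟩⟩
  filter_upwards [hb, hX.1.ae_eq_mk] with ω h1 h2
  rw [← h2]
  have h3 := abs_le.1 h1
  rw [min_eq_right (by linarith), max_eq_right (by linarith)]

/-- Discretization of a real number in `[-C, C]`, rounding up with step `δ`. -/
def discretize (C δ x : ℝ) : ℕ := ⌈(x + C) / δ⌉₊

variable {C δ x : ℝ}

lemma discretize_mono (hδ : 0 < δ) : Monotone (discretize C δ) := fun x y hxy =>
  Nat.ceil_mono (by gcongr)

lemma discretize_le (hδ : 0 < δ) (hx : x ≤ C) : discretize C δ x ≤ ⌈2 * C / δ⌉₊ :=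
  Nat.ceil_mono (by gcongr; linarith)

lemma le_discretize (hδ : 0 < δ) : x ≤ -C + δ * discretize C δ x := by
  have : (x + C) / δ ≤ discretize C δ x := Nat.le_ceil _
  rw [div_le_iff₀ hδ] at this
  linarith

lemma discretize_le_add (hδ : 0 < δ) (hx : -C ≤ x) : -C + δ * discretize C δ x ≤ x + δ := by
  have h0 : 0 ≤ (x + C) / δ := div_nonneg (by linarith) hδ.le
  have : (discretize C δ x : ℝ) < (x + C) / δ + 1 := Nat.ceil_lt_add_one h0
  rw [← sub_lt_iff_lt_add, lt_div_iff₀ hδ] at this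
  linarith

variable [IsProbabilityMeasure P]

lemma le_mul_ceil (hδ : 0 < δ) : 2 * C ≤ δ * ⌈2 * C / δ⌉₊ := by
  have := Nat.le_ceil (2 * C / δ)
  rw [div_le_iff₀ hδ] at this
  linarith

lemma riskMeasure_affine_discretize (hh : IsDistortion h) (hC : 0 < C) (hδ : 0 < δ)
    (hX : ∀ ω, X ω ∈ Icc (-C) C) :
    riskMeasure P h (fun ω => -C + δ * (discretize C δ (X ω) : ℕ)) =
      -C + δ * natChoquet (distorted P h) ⌈2 * C / δ⌉₊ fun ω => discretize C δ (X ω) :=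
  riskMeasure_affine_nat hh (fun ω => discretize_le hδ (hX ω).2) hδ (by linarith)
    (by linarith [le_mul_ceil (C := C) hδ])

/-- The discretized distortion risk measure is an upper approximation. -/
lemma natChoquet_discretize_le (hh : IsDistortion h) (hC : 0 < C) (hδ : 0 < δ)
    (hX : ∀ ω, X ω ∈ Icc (-C) C) :
    -C + δ * natChoquet (distorted P h) ⌈2 * C / δ⌉₊ (fun ω => discretize C δ (X ω)) ≤
      riskMeasure P h X + δ := by
  rw [← riskMeasure_affine_discretize hh hC hδ hX, ← riskMeasure_add_const hh hC.le hδ.le hX]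
  refine riskMeasure_mono hh (C := C + δ) (by linarith) (fun ω => ?_) (fun ω => ?_) fun ω =>
    discretize_le_add hδ (hX ω).1
  · have h1 := le_discretize (C := C) (x := X ω) hδ
    have h2 := discretize_le_add (C := C) hδ (hX ω).1
    exact ⟨by linarith [(hX ω).1], by linarith [(hX ω).2]⟩
  · exact ⟨by linarith [(hX ω).1], by linarith [(hX ω).2]⟩

/-- Subadditivity for essentially bounded variables follows from subadditivity for discretized
variables. -/
lemma riskMeasure_add_le_of_nat (hh : IsDistortion h) (hX : MemLp X ⊤ P) (hY : MemLp Y ⊤ P)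
    (H : ∀ X' Y' : Ω → ℝ, Measurable X' → Measurable Y' → X =ᵐ[P] X' → Y =ᵐ[P] Y' →
      ∀ φ ψ : ℝ → ℕ, Monotone φ → Monotone ψ → ∀ N, (∀ ω, φ (X' ω) ≤ N) → (∀ ω, ψ (Y' ω) ≤ N) →
        natChoquet (distorted P h) (N + N) (fun ω => φ (X' ω) + ψ (Y' ω)) ≤
          natChoquet (distorted P h) N (fun ω => φ (X' ω)) +
            natChoquet (distorted P h) N fun ω => ψ (Y' ω)) :
    riskMeasure P h (fun ω => X ω + Y ω) ≤ riskMeasure P h X + riskMeasure P h Y := by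
  obtain ⟨X', hX'm, hXX', C₁, hC₁, hX'⟩ := exists_measurable_bounded hX
  obtain ⟨Y', hY'm, hYY', C₂, hC₂, hY'⟩ := exists_measurable_bounded hY
  have hsum : (fun ω => X ω + Y ω) =ᵐ[P] fun ω => X' ω + Y' ω := hXX'.add hYY'
  rw [riskMeasure_congr hXX', riskMeasure_congr hYY', riskMeasure_congr hsum]
  set C := max C₁ C₂
  have hC : 0 < C := lt_max_of_lt_left hC₁
  have hXC : ∀ ω, X' ω ∈ Icc (-C) C := fun ω =>
    Icc_subset_Icc (neg_le_neg (le_max_left _ _)) (le_max_left _ _) (hX' ω)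
  have hYC : ∀ ω, Y' ω ∈ Icc (-C) C := fun ω =>
    Icc_subset_Icc (neg_le_neg (le_max_right _ _)) (le_max_right _ _) (hY' ω)
  refine le_of_forall_pos_le_add fun ε hε => ?_
  -- Rounding up only increases the risk of the sum and raises that of each summand by at most `δ`,
  -- for a total error of `2 δ = ε`.
  set δ := ε / 2
  have hδ : 0 < δ := half_pos hε
  set N := ⌈2 * C / δ⌉₊ with hN
  have hNX : ∀ ω, discretize C δ (X' ω) ≤ N := fun ω => discretize_le hδ (hXC ω).2
  have hNY : ∀ ω, discretize C δ (Y' ω) ≤ N := fun ω => discretize_le hδ (hYC ω).2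
  have h1 := H X' Y' hX'm hY'm hXX' hYY' _ _ (discretize_mono (C := C) hδ)
    (discretize_mono (C := C) hδ) N hNX hNY
  have h2 := natChoquet_discretize_le (P := P) hh hC hδ hXC
  have h3 := natChoquet_discretize_le (P := P) hh hC hδ hYC
  have hNC : 2 * C ≤ δ * N := le_mul_ceil hδ
  have h4 := riskMeasure_affine_nat (P := P) hh (N := N + N)
    (fun ω => add_le_add (hNX ω) (hNY ω)) hδ (a := -(2 * C)) (by linarith)
    (by push_cast; linarith)
  have h5 : riskMeasure P h (fun ω => X' ω + Y' ω) ≤ riskMeasure P h (fun ω => -(2 * C) +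
      δ * ((discretize C δ (X' ω) + discretize C δ (Y' ω) : ℕ) : ℝ)) := by
    refine riskMeasure_mono hh (C := 2 * C + 2 * δ) (by linarith) (fun ω => ?_) (fun ω => ?_)
      fun ω => ?_
    · exact ⟨by linarith [(hXC ω).1, (hYC ω).1], by linarith [(hXC ω).2, (hYC ω).2]⟩
    all_goals
      have e1 := le_discretize (C := C) (x := X' ω) hδ
      have e2 := discretize_le_add (C := C) hδ (hXC ω).1
      have e3 := le_discretize (C := C) (x := Y' ω) hδ
      have e4 := discretize_le_add (C := C) hδ (hYC ω).1
      push_cast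
    · exact ⟨by linarith [(hXC ω).1, (hYC ω).1], by linarith [(hXC ω).2, (hYC ω).2]⟩
    · linarith
  have h6 : δ * natChoquet (distorted P h) (N + N)
      (fun ω => discretize C δ (X' ω) + discretize C δ (Y' ω)) ≤
      δ * natChoquet (distorted P h) N (fun ω => discretize C δ (X' ω)) +
        δ * natChoquet (distorted P h) N (fun ω => discretize C δ (Y' ω)) := by
    rw [← mul_add]
    gcongr
  have hε2 : δ + δ = ε := add_halves ε
  linarith

end Approximation

section Subadditivity

variable [IsProbabilityMeasure P]

/-- Monotone transforms of comonotonic variables have nested upper level sets. -/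
lemma Comonotonic.nested (hXY : Comonotonic P X Y) {φ ψ : ℝ → ℕ} (hφ : Monotone φ)
    (hψ : Monotone ψ) (j k : ℕ) :
    (∀ᵐ ω ∂P, j ≤ φ (X ω) → k ≤ ψ (Y ω)) ∨ ∀ᵐ ω ∂P, k ≤ ψ (Y ω) → j ≤ φ (X ω) := by
  by_contra hcon
  rw [not_or, Filter.not_eventually, Filter.not_eventually] at hcon
  obtain ⟨ω, h1, h2⟩ := (hcon.1.and_eventually (Measure.ae_ae_of_ae_prod hXY)).exists
  obtain ⟨ω', h3, h4⟩ := (hcon.2.and_eventually h2).exists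
  push Not at h1 h3
  have hX : X ω' < X ω := hφ.reflect_lt (h3.2.trans_le h1.1)
  have hY : Y ω < Y ω' := hψ.reflect_lt (h1.2.trans_le h3.1)
  exact absurd h4 (not_le.2 (mul_neg_of_pos_of_neg (sub_pos.2 hX) (sub_neg.2 hY)))

/-- Upper level sets of monotone transforms of counter-monotonic variables are disjoint or
cover the whole space. -/
lemma CounterMonotonic.disjoint_or_cover (hXY : CounterMonotonic P X Y) {φ ψ : ℝ → ℕ}
    (hφ : Monotone φ) (hψ : Monotone ψ) (j k : ℕ) :
    (∀ᵐ ω ∂P, ¬(j ≤ φ (X ω) ∧ k ≤ ψ (Y ω))) ∨ ∀ᵐ ω ∂P, j ≤ φ (X ω) ∨ k ≤ ψ (Y ω) := by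
  by_contra hcon
  rw [not_or, Filter.not_eventually, Filter.not_eventually] at hcon
  obtain ⟨ω, h1, h2⟩ := (hcon.1.and_eventually (Measure.ae_ae_of_ae_prod hXY)).exists
  obtain ⟨ω', h3, h4⟩ := (hcon.2.and_eventually h2).exists
  rw [not_not] at h1
  push Not at h3
  have hX : X ω' < X ω := hφ.reflect_lt (h3.1.trans_le h1.1)
  have hY : Y ω' < Y ω := hψ.reflect_lt (h3.2.trans_le h1.2)
  exact absurd h4 (not_le.2 (mul_pos (sub_pos.2 hX) (sub_pos.2 hY)))

lemma riskMeasure_add_le_of_concaveOn (hh : IsDistortion h) (hc : ConcaveOn ℝ (Icc 0 1) h)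
    (hX : MemLp X ⊤ P) (hY : MemLp Y ⊤ P) :
    riskMeasure P h (fun ω => X ω + Y ω) ≤ riskMeasure P h X + riskMeasure P h Y :=
  riskMeasure_add_le_of_nat hh hX hY fun _ _ hXm hYm _ _ _ _ hφ hψ _ hX' hY' =>
    natChoquet_add_le_of_concaveOn hh hc (hφ.measurable.comp hXm) (hψ.measurable.comp hYm) hX' hY'

lemma riskMeasure_add_le_of_comonotonic (hh : IsDistortion h) (hXY : Comonotonic P X Y)
    (hX : MemLp X ⊤ P) (hY : MemLp Y ⊤ P) :
    riskMeasure P h (fun ω => X ω + Y ω) ≤ riskMeasure P h X + riskMeasure P h Y :=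
  riskMeasure_add_le_of_nat hh hX hY fun _ _ _ _ hXX' hYY' _ _ hφ hψ _ hX' hY' =>
    natChoquet_add_le_of_nested hh (fun j k => by
      refine (hXY.nested hφ hψ j k).imp (fun H => ?_) fun H => ?_ <;>
        filter_upwards [H, hXX', hYY'] with ω h1 h2 h3 <;> rwa [← h2, ← h3]) hX' hY'

lemma riskMeasure_add_le_of_counterMonotonic (hh : IsDistortion h) (hd : DuallySubadditive h)
    (hXY : CounterMonotonic P X Y) (hX : MemLp X ⊤ P) (hY : MemLp Y ⊤ P) :
    riskMeasure P h (fun ω => X ω + Y ω) ≤ riskMeasure P h X + riskMeasure P h Y :=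
  riskMeasure_add_le_of_nat hh hX hY fun _ _ hXm hYm hXX' hYY' _ _ hφ hψ _ hX' hY' =>
    natChoquet_add_le_of_disjoint_or_cover hh hd (hφ.measurable.comp hXm)
      (hψ.measurable.comp hYm) hX' hY' (fun j k => by
      refine (hXY.disjoint_or_cover hφ hψ j k).imp (fun H => ?_) fun H => ?_ <;>
        filter_upwards [H, hXX', hYY'] with ω h1 h2 h3 <;> simpa only [← h2, ← h3] using h1)

lemma riskMeasure_zero (hh : IsDistortion h) : riskMeasure P h (fun _ => 0) = 0 := by
  rw [riskMeasure_eq_intervalIntegral hh le_rfl le_rfl fun _ => ⟨le_rfl, le_rfl⟩]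
  simp

lemma riskMeasure_neg_const (hh : IsDistortion h) {C : ℝ} (hC : 0 ≤ C) :
    riskMeasure P h (fun _ => -C) = -C := by
  have := riskMeasure_add_const (P := P) hh hC hC (X := fun _ => -C)
    fun _ => ⟨le_rfl, by linarith⟩
  simp only [neg_add_cancel, riskMeasure_zero hh] at this
  linarith

lemma riskMeasure_sum_le {ι : Type*} (hh : IsDistortion h) {Y : ι → Ω → ℝ}
    (hadd : ∀ (s : Finset ι) (j : ι), j ∉ s →
      riskMeasure P h (fun ω => ∑ i ∈ s, Y i ω + Y j ω) ≤
        riskMeasure P h (fun ω => ∑ i ∈ s, Y i ω) + riskMeasure P h (Y j)) (s : Finset ι) :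
    riskMeasure P h (fun ω => ∑ i ∈ s, Y i ω) ≤ ∑ i ∈ s, riskMeasure P h (Y i) := by
  classical
  induction s using Finset.induction_on with
  | empty => simpa using (riskMeasure_zero hh).le
  | insert j s hj ih =>
    simp only [Finset.sum_insert hj]
    have := hadd s j hj
    simp only [add_comm (Y j _)]
    linarith

lemma riskMeasure_sum_le_of_concaveOn {ι : Type*} (hh : IsDistortion h)
    (hc : ConcaveOn ℝ (Icc 0 1) h) {Y : ι → Ω → ℝ} (hY : ∀ i, MemLp (Y i) ⊤ P) (s : Finset ι) :
    riskMeasure P h (fun ω => ∑ i ∈ s, Y i ω) ≤ ∑ i ∈ s, riskMeasure P h (Y i) :=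
  riskMeasure_sum_le hh (fun s j _ => riskMeasure_add_le_of_concaveOn hh hc
    (memLp_finsetSum s fun i _ => hY i) (hY j)) s

/-- Pairwise comonotonicity suffices for the induction: the increment of a partial sum times that of
a further component is a sum of nonnegative products. -/
lemma riskMeasure_sum_le_of_comonotonic {ι : Type*} (hh : IsDistortion h) {Y : ι → Ω → ℝ}
    (hY : ∀ i, MemLp (Y i) ⊤ P) (hco : ∀ i j, i ≠ j → Comonotonic P (Y i) (Y j))
    (s : Finset ι) :
    riskMeasure P h (fun ω => ∑ i ∈ s, Y i ω) ≤ ∑ i ∈ s, riskMeasure P h (Y i) := by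
  refine riskMeasure_sum_le hh (fun s j hj => riskMeasure_add_le_of_comonotonic hh ?_
    (memLp_finsetSum s fun i _ => hY i) (hY j)) s
  have : ∀ᵐ p ∂(P.prod P), ∀ i ∈ s, 0 ≤ (Y i p.1 - Y i p.2) * (Y j p.1 - Y j p.2) :=
    (Filter.eventually_all_finset s).2 fun i hi => hco i j (ne_of_mem_of_not_mem hi hj)
  filter_upwards [this] with p hp
  rw [← Finset.sum_sub_distrib, Finset.sum_mul]
  exact Finset.sum_nonneg hp

lemma riskMeasure_sum_le_of_counterMonotonic {ι : Type*} (hh : IsDistortion h)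
    (hd : DuallySubadditive h) {Y : ι → Ω → ℝ}
    (hY : ∀ i, MemLp (Y i) ⊤ P) (hco : ∀ i j, i ≠ j → CounterMonotonic P (Y i) (Y j))
    (s : Finset ι) :
    riskMeasure P h (fun ω => ∑ i ∈ s, Y i ω) ≤ ∑ i ∈ s, riskMeasure P h (Y i) := by
  refine riskMeasure_sum_le hh (fun s j hj => riskMeasure_add_le_of_counterMonotonic hh hd ?_
    (memLp_finsetSum s fun i _ => hY i) (hY j)) s
  have : ∀ᵐ p ∂(P.prod P), ∀ i ∈ s, (Y i p.1 - Y i p.2) * (Y j p.1 - Y j p.2) ≤ 0 :=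
    (Filter.eventually_all_finset s).2 fun i hi => hco i j (ne_of_mem_of_not_mem hi hj)
  filter_upwards [this] with p hp
  rw [← Finset.sum_sub_distrib, Finset.sum_mul]
  exact Finset.sum_nonpos hp

end Subadditivity

/-! ### The minimum of finitely many distortions. -/

section MinDistortion

variable {n : ℕ} {f : Fin n → ℝ → ℝ}

lemma minDistortion_le (f : Fin n → ℝ → ℝ) (i : Fin n) (t : ℝ) : minDistortion f t ≤ f i t :=
  ciInf_le (Set.finite_range _).bddBelow i

lemma exists_eq_minDistortion (hn : 1 ≤ n) (f : Fin n → ℝ → ℝ) (t : ℝ) :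
    ∃ i, f i t = minDistortion f t :=
  have : Nonempty (Fin n) := ⟨⟨0, hn⟩⟩
  exists_eq_ciInf_of_finite

lemma isDistortion_minDistortion (hn : 1 ≤ n) (hf : ∀ i, IsDistortion (f i)) :
    IsDistortion (minDistortion f) where
  mapsTo t ht := by
    obtain ⟨i, hi⟩ := exists_eq_minDistortion hn f t
    exact hi ▸ (hf i).mapsTo ht
  mono s hs t ht hst := by
    obtain ⟨i, hi⟩ := exists_eq_minDistortion hn f t
    exact (minDistortion_le f i s).trans (hi ▸ (hf i).mono hs ht hst)
  map_zero := by
    obtain ⟨i, hi⟩ := exists_eq_minDistortion hn f 0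
    rw [← hi, (hf i).map_zero]
  map_one := by
    obtain ⟨i, hi⟩ := exists_eq_minDistortion hn f 1
    rw [← hi, (hf i).map_one]

lemma riskMeasure_minDistortion_le [IsProbabilityMeasure P] (hf : ∀ i, IsDistortion (f i))
    (i : Fin n) (hX : MemLp X ⊤ P) :
    riskMeasure P (minDistortion f) X ≤ riskMeasure P (f i) X := by
  obtain ⟨X', -, hXX', C, hC, hX'⟩ := exists_measurable_bounded hX
  rw [riskMeasure_congr hXX', riskMeasure_congr hXX']
  exact riskMeasure_mono_distortion
    (isDistortion_minDistortion (Nat.one_le_iff_ne_zero.2 (by rintro rfl; exact i.elim0)) hf)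
    (hf i) (fun t _ => minDistortion_le f i t) hC.le hX'

end MinDistortion

end Transfer

variable {Ω : Type*} [MeasurableSpace Ω] {P : Measure Ω} {X Y : Ω → ℝ}

/-! ### Almost optimal comonotonic allocations by layers. -/

section ComonotonicAllocation

lemma sum_range_clamp (N : ℕ) {x : ℝ} (hx : 0 ≤ x) :
    ∑ k ∈ Finset.range N, max 0 (min (x - k) 1) = min x N := by
  induction N with
  | zero => simp [hx]
  | succ N ih =>
    rw [Finset.sum_range_succ, ih]
    push_cast
    rcases le_total x N with h | h
    · rw [min_eq_left h, min_eq_left (by linarith : x ≤ N + 1),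
        max_eq_left ((min_le_left _ _).trans (by linarith)), add_zero]
    · rcases le_total x (N + 1) with h' | h'
      · rw [min_eq_right h, min_eq_left h', min_eq_left (by linarith), max_eq_right (by linarith)]
        ring
      · rw [min_eq_right h, min_eq_right h', min_eq_right (by linarith), max_eq_right zero_le_one]

/-- The layer of `x` between `-C + δ * k` and `-C + δ * (k + 1)`. -/
def layer (C δ : ℝ) (k : ℕ) (x : ℝ) : ℝ := δ * max 0 (min ((x + C) / δ - k) 1)

variable {C δ : ℝ}

lemma layer_mono (hδ : 0 < δ) (k : ℕ) : Monotone (layer C δ k) := fun x y hxy => by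
  unfold layer
  gcongr

lemma layer_mem_Icc (hδ : 0 < δ) (k : ℕ) (x : ℝ) : layer C δ k x ∈ Icc 0 δ :=
  ⟨mul_nonneg hδ.le (le_max_left _ _),
    mul_le_of_le_one_right hδ.le (max_le zero_le_one (min_le_right _ _))⟩

lemma sum_layer (hδ : 0 < δ) {x : ℝ} (hx : x ∈ Icc (-C) C) :
    ∑ k ∈ Finset.range ⌈2 * C / δ⌉₊, layer C δ k x = x + C := by
  unfold layer
  rw [← Finset.mul_sum, sum_range_clamp _ (div_nonneg (by linarith [hx.1]) hδ.le),
    min_eq_left, mul_div_cancel₀ _ hδ.ne']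
  exact le_trans (by gcongr; linarith [hx.2]) (Nat.le_ceil _)

lemma comonotonic_comp_of_monotone {φ ψ : ℝ → ℝ} (hφ : Monotone φ) (hψ : Monotone ψ)
    (X : Ω → ℝ) : Comonotonic P (fun ω => φ (X ω)) fun ω => ψ (X ω) :=
  ae_of_all _ fun p => by
    rcases le_total (X p.1) (X p.2) with h | h
    · exact mul_nonneg_of_nonpos_of_nonpos (sub_nonpos.2 (hφ h)) (sub_nonpos.2 (hψ h))
    · exact mul_nonneg (sub_nonneg.2 (hφ h)) (sub_nonneg.2 (hψ h))

lemma memLp_layer (hX : Measurable X) (hδ : 0 < δ) (k : ℕ) :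
    MemLp (fun ω => layer C δ k (X ω)) ⊤ P :=
  memLp_top_of_bound ((layer_mono hδ k).measurable.comp hX).aestronglyMeasurable δ
    (ae_of_all _ fun ω => by
      have := layer_mem_Icc (C := C) hδ k (X ω)
      rw [Real.norm_eq_abs, abs_of_nonneg this.1]
      exact this.2)

variable [IsProbabilityMeasure P]

/-- A layer vanishes unless `X` exceeds its lower end `-C + δ * k`, which is the event `k + 1 ≤
discretize C δ (X ω)`, and it is at most `δ`. The bound is thus the risk of `δ` times an indicator.
-/
lemma riskMeasure_layer_le {h : ℝ → ℝ} (hh : IsDistortion h) (hδ : 0 < δ) (k : ℕ) :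
    riskMeasure P h (fun ω => layer C δ k (X ω)) ≤
      δ * distorted P h {ω | k + 1 ≤ discretize C δ (X ω)} := by
  set Z : Ω → ℕ := fun ω => if k + 1 ≤ discretize C δ (X ω) then 1 else 0 with hZ
  have h1 := riskMeasure_affine_nat (P := P) hh (N := 1) (Z := Z)
    (fun ω => by simp only [hZ]; split_ifs <;> omega) hδ le_rfl (by simpa using hδ.le)
  have h2 : {ω | 1 ≤ Z ω} = {ω | k + 1 ≤ discretize C δ (X ω)} := by
    ext ω
    simp only [hZ, mem_ofPred_eq]
    split_ifs <;> omega
  simp only [natChoquet, Finset.sum_range_one, zero_add, h2] at h1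
  rw [← h1]
  refine riskMeasure_mono hh hδ.le (fun ω => ?_) (fun ω => ?_) fun ω => ?_
  · have := layer_mem_Icc (C := C) hδ k (X ω)
    exact ⟨by linarith [this.1], this.2⟩
  · simp only [hZ]
    split_ifs
    · simp only [Nat.cast_one, mul_one]; exact ⟨by linarith, le_rfl⟩
    · simp only [Nat.cast_zero, mul_zero]; exact ⟨by linarith, hδ.le⟩
  · simp only [hZ]
    split_ifs with hk
    · simpa using (layer_mem_Icc (C := C) hδ k (X ω)).2
    · have h3 : (X ω + C) / δ ≤ k := Nat.ceil_le.1 (by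
        change ¬(k + 1 ≤ ⌈(X ω + C) / δ⌉₊) at hk
        omega)
      rw [layer, max_eq_left ((min_le_left _ _).trans (sub_nonpos.2 h3))]
      simp

/-- Allocating each thin layer of `X` to the agent whose distortion is smallest there gives a
comonotonic allocation that is almost optimal. -/
lemma exists_comonotonicAllocation_le {n : ℕ} (hn : 1 ≤ n) {f : Fin n → ℝ → ℝ}
    (hf : ∀ i, IsDistortion (f i)) (hX : MemLp X ⊤ P) {ε : ℝ} (hε : 0 < ε) :
    ∃ Y ∈ comonotonicAllocations P n X,
      ∑ i, riskMeasure P (f i) (Y i) ≤ riskMeasure P (minDistortion f) X + ε := by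
  obtain ⟨X', hX'm, hXX', C, hC, hX'⟩ := exists_measurable_bounded hX
  rw [riskMeasure_congr hXX']
  set N := ⌈2 * C / ε⌉₊ with hN
  choose a ha using fun k : ℕ =>
    exists_eq_minDistortion hn f (P.real {ω | k + 1 ≤ discretize C ε (X' ω)})
  set s : Fin n → Finset ℕ := fun i => (Finset.range N).filter fun k => a k = i
  -- The layers add up to `X' + C`; the first agent absorbs the constant `-C`.
  set c : Fin n → ℝ := fun i => if i = ⟨0, hn⟩ then -C else 0
  set g : Fin n → ℝ → ℝ := fun i x => ∑ k ∈ s i, layer C ε k x + c i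
  have hg : ∀ i, Monotone (g i) := fun i x y hxy =>
    add_le_add_left (Finset.sum_le_sum fun k _ => layer_mono hε k hxy) _
  have hfib : ∀ F : ℕ → ℝ, ∑ i, ∑ k ∈ s i, F k = ∑ k ∈ Finset.range N, F k := fun F =>
    Finset.sum_fiberwise (Finset.range N) a F
  have hc : ∑ i, c i = -C := by simp [c]
  have hlayer : ∀ k, MemLp (fun ω => layer C ε k (X' ω)) ⊤ P := memLp_layer hX'm hε
  have hsum : ∀ i, MemLp (fun ω => ∑ k ∈ s i, layer C ε k (X' ω)) ⊤ P := fun i =>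
    memLp_finsetSum (s i) fun k _ => hlayer k
  refine ⟨fun i ω => g i (X' ω), ⟨⟨fun i => (hsum i).add (memLp_const (c i)), ?_⟩,
    fun i j _ => comonotonic_comp_of_monotone (hg i) (hg j) X'⟩, ?_⟩
  · filter_upwards [hXX'] with ω hω
    simp only [g]
    rw [Finset.sum_add_distrib, hfib fun k => layer C ε k (X' ω), hc, sum_layer hε (hX' ω), hω]
    ring
  have hrho : ∀ i, riskMeasure P (f i) (fun ω => g i (X' ω)) ≤
      ∑ k ∈ s i, ε * distorted P (minDistortion f) {ω | k + 1 ≤ discretize C ε (X' ω)} + c i := by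
    intro i
    have h1 : riskMeasure P (f i) (fun ω => g i (X' ω)) ≤ _ :=
      riskMeasure_add_le_of_comonotonic (hf i) (comonotonic_comp_of_monotone
        (φ := fun x => ∑ k ∈ s i, layer C ε k x) (ψ := fun _ => c i)
        (fun x y hxy => Finset.sum_le_sum fun k _ => layer_mono hε k hxy)
        monotone_const X') (hsum i) (memLp_const (c i))
    have h2 := riskMeasure_sum_le_of_comonotonic (hf i) hlayer
      (fun k l _ => comonotonic_comp_of_monotone (layer_mono hε k) (layer_mono hε l) X') (s i)
    have h3 : riskMeasure P (f i) (fun _ => c i) = c i := by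
      simp only [c]
      split_ifs
      · exact riskMeasure_neg_const (hf i) hC.le
      · exact riskMeasure_zero (hf i)
    have h4 : ∑ k ∈ s i, riskMeasure P (f i) (fun ω => layer C ε k (X' ω)) ≤
        ∑ k ∈ s i, ε * distorted P (minDistortion f) {ω | k + 1 ≤ discretize C ε (X' ω)} := by
      refine Finset.sum_le_sum fun k hk => (riskMeasure_layer_le (hf i) hε k).trans_eq ?_
      rw [distorted, distorted, ← ha k, (Finset.mem_filter.1 hk).2]
    linarith
  have htotal := Finset.sum_le_sum fun i (_ : i ∈ Finset.univ) => hrho i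
  rw [Finset.sum_add_distrib, hc, hfib, ← Finset.mul_sum] at htotal
  have := natChoquet_discretize_le (P := P) (isDistortion_minDistortion hn hf) hC hε hX'
  unfold natChoquet at this
  linarith

end ComonotonicAllocation

/-! ### Bounds for the three inf-convolutions. -/

section InfConvolution

lemma coe_le_infAggregate {S : Type*} {n : ℕ} {ρ : Fin n → (S → ℝ) → ℝ} {A : Set (Fin n → S → ℝ)} {r : ℝ}
    (H : ∀ Y ∈ A, r ≤ ∑ i, ρ i (Y i)) : (r : EReal) ≤ infAggregate ρ A :=
  le_iInf₂ fun Y hY => EReal.coe_le_coe_iff.2 (H Y hY)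

lemma infAggregate_le {S : Type*} {n : ℕ} {ρ : Fin n → (S → ℝ) → ℝ} {A : Set (Fin n → S → ℝ)} {r : ℝ}
    {Y : Fin n → S → ℝ} (hY : Y ∈ A) (hr : ∑ i, ρ i (Y i) ≤ r) : infAggregate ρ A ≤ r :=
  iInf₂_le_of_le Y hY (EReal.coe_le_coe_iff.2 hr)

lemma infConv_le_comonotonicInfConv {n : ℕ} (f : Fin n → ℝ → ℝ) (X : Ω → ℝ) :
    infConv P f X ≤ comonotonicInfConv P f X :=
  biInf_mono fun _ hY => hY.1

lemma infConv_le_counterMonotonicInfConv {n : ℕ} (f : Fin n → ℝ → ℝ) (X : Ω → ℝ) :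
    infConv P f X ≤ counterMonotonicInfConv P f X :=
  biInf_mono fun _ hY => hY.1

variable [IsProbabilityMeasure P] {n : ℕ} {f : Fin n → ℝ → ℝ}

/-- The common lower bound: `hsum` is supplied by whichever subadditivity fits the class of
allocations. -/
lemma riskMeasure_minDistortion_le_sum (hf : ∀ i, IsDistortion (f i)) {Y : Fin n → Ω → ℝ}
    (hY : Y ∈ allocations P n X)
    (hsum : riskMeasure P (minDistortion f) (fun ω => ∑ i, Y i ω) ≤
      ∑ i, riskMeasure P (minDistortion f) (Y i)) :
    riskMeasure P (minDistortion f) X ≤ ∑ i, riskMeasure P (f i) (Y i) := by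
  rw [← riskMeasure_congr hY.2]
  exact hsum.trans (Finset.sum_le_sum fun i _ => riskMeasure_minDistortion_le hf i (hY.1 i))

lemma comonotonicInfConv_eq (hn : 1 ≤ n) (hf : ∀ i, IsDistortion (f i)) (hX : MemLp X ⊤ P) :
    comonotonicInfConv P f X = (riskMeasure P (minDistortion f) X : EReal) := by
  refine le_antisymm (not_lt.1 fun hlt => ?_) (coe_le_infAggregate fun Y hY =>
    riskMeasure_minDistortion_le_sum hf hY.1 (riskMeasure_sum_le_of_comonotonic
      (isDistortion_minDistortion hn hf) hY.1.1 hY.2 _))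
  obtain ⟨r, hr1, hr2⟩ := EReal.lt_iff_exists_real_btwn.1 hlt
  obtain ⟨Y, hY, hle⟩ := exists_comonotonicAllocation_le hn hf hX
    (sub_pos.2 (EReal.coe_lt_coe_iff.1 hr1))
  exact absurd hr2 (not_lt.2 (infAggregate_le hY (by linarith)))

lemma le_counterMonotonicInfConv (hn : 1 ≤ n) (hf : ∀ i, IsDistortion (f i))
    (hd : DuallySubadditive (minDistortion f)) (X : Ω → ℝ) :
    (riskMeasure P (minDistortion f) X : EReal) ≤ counterMonotonicInfConv P f X :=
  coe_le_infAggregate fun _ hY =>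
    riskMeasure_minDistortion_le_sum hf hY.1 (riskMeasure_sum_le_of_counterMonotonic
      (isDistortion_minDistortion hn hf) hd hY.1.1 hY.2 _)

lemma le_infConv_of_concaveOn (hn : 1 ≤ n) (hf : ∀ i, IsDistortion (f i))
    (hc : ConcaveOn ℝ (Icc 0 1) (minDistortion f)) (X : Ω → ℝ) :
    (riskMeasure P (minDistortion f) X : EReal) ≤ infConv P f X :=
  coe_le_infAggregate fun _ hY =>
    riskMeasure_minDistortion_le_sum hf hY (riskMeasure_sum_le_of_concaveOn
      (isDistortion_minDistortion hn hf) hc hY.1 _)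

lemma infConv_le_riskMeasure (hn : 1 ≤ n) (hf : ∀ i, IsDistortion (f i)) (hX : MemLp X ⊤ P) :
    infConv P f X ≤ (riskMeasure P (minDistortion f) X : EReal) :=
  (infConv_le_comonotonicInfConv f X).trans_eq (comonotonicInfConv_eq hn hf hX)

/-- Giving everything to an agent with the smallest distortion is counter-monotonic. -/
lemma counterMonotonicInfConv_le (hf : ∀ i, IsDistortion (f i)) {j : Fin n}
    (hj : EqOn (f j) (minDistortion f) (Icc 0 1)) (hX : MemLp X ⊤ P) :
    counterMonotonicInfConv P f X ≤ (riskMeasure P (minDistortion f) X : EReal) := by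
  refine infAggregate_le (Y := fun i => if i = j then X else fun _ => 0)
    ⟨⟨fun i => ?_, ae_of_all _ fun ω => ?_⟩, fun i k hik => ae_of_all _ fun p => ?_⟩ ?_
  · dsimp only
    split_ifs
    · exact hX
    · exact memLp_const 0
  · dsimp only
    rw [Finset.sum_eq_single j (fun i _ hi => by simp [hi]) (by simp), if_pos rfl]
  · by_cases hi : i = j
    · simp [show k ≠ j from fun h => hik (hi.trans h.symm)]
    · simp [hi]
  · rw [Finset.sum_eq_single j (fun i _ hi => by simp [hi, riskMeasure_zero (hf i)]) (by simp),
      if_pos rfl, riskMeasure_congr_distortion hj]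

lemma concaveRelation_minDistortion (hn : 1 ≤ n) (hf : ∀ i, IsDistortion (f i))
    (hc : ConcaveOn ℝ (Icc 0 1) (minDistortion f)) :
    ConcaveRelation P f (minDistortion f) := fun X hX => by
  have h1 := comonotonicInfConv_eq hn hf hX
  have h2 := le_infConv_of_concaveOn (P := P) hn hf hc X
  exact ⟨h1.trans_le (h2.trans (infConv_le_counterMonotonicInfConv f X)), h1,
    h2.antisymm (infConv_le_riskMeasure hn hf hX)⟩

end InfConvolution

/-! ### Necessity of concavity and dual subadditivity. -/

section Converse

variable {h : ℝ → ℝ}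

/-- The family allocating `X` and `Y` to the first two agents and nothing to the others. -/
def twoAgents (n : ℕ) (X Y : Ω → ℝ) (i : Fin n) : Ω → ℝ :=
  if i.val = 0 then X else if i.val = 1 then Y else fun _ => 0

/-- The functional is arbitrary so that evaluation at a point and the risk measure are both covered.
-/
lemma sum_twoAgents {n : ℕ} (hn : 2 ≤ n) {S : Type*} {X Y : S → ℝ} (F : (S → ℝ) → ℝ)
    (hF : F (fun _ => 0) = 0) : ∑ i : Fin n, F (twoAgents n X Y i) = F X + F Y := by
  obtain ⟨m, rfl⟩ : ∃ m, n = m + 2 := ⟨n - 2, by omega⟩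
  rw [Fin.sum_univ_succ, Fin.sum_univ_succ]
  simp [twoAgents, hF]

lemma twoAgents_mem_allocations {n : ℕ} (hn : 2 ≤ n) [IsFiniteMeasure P] (hX : MemLp X ⊤ P)
    (hY : MemLp Y ⊤ P) : twoAgents n X Y ∈ allocations P n (fun ω => X ω + Y ω) := by
  refine ⟨fun i => ?_, ae_of_all _ fun ω => sum_twoAgents hn (fun Z => Z ω) rfl⟩
  unfold twoAgents
  split_ifs
  exacts [hX, hY, memLp_const 0]

lemma twoAgents_mem_counterMonotonicAllocations {n : ℕ} (hn : 2 ≤ n) [IsFiniteMeasure P]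
    (hX : MemLp X ⊤ P) (hY : MemLp Y ⊤ P) (hXY : CounterMonotonic P X Y) :
    twoAgents n X Y ∈ counterMonotonicAllocations P n (fun ω => X ω + Y ω) := by
  refine ⟨twoAgents_mem_allocations hn hX hY, fun i j hij => hXY.mono fun p hp => ?_⟩
  have hij' : i.val ≠ j.val := fun h => hij (Fin.ext h)
  unfold twoAgents
  split_ifs
  all_goals first
    | omega
    | exact hp
    | rwa [mul_comm]
    | simp

/-- The real-valued indicator of `s`, shifted by `a`. -/
def shiftedIndicator (a : ℝ) (s : Set Ω) (ω : Ω) : ℝ := a + s.indicator 1 ω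

variable {a : ℝ} {s t : Set Ω}

/-- The hypothesis says that `s` and `t` are disjoint or cover the space; a violating pair would
have one point in both sets and the other in neither. -/
lemma counterMonotonic_shiftedIndicator (hst : ∀ ω ω', ω ∈ s → ω ∈ t → ω' ∈ s ∨ ω' ∈ t) :
    CounterMonotonic P (shiftedIndicator a s) (shiftedIndicator a t) :=
  ae_of_all _ fun p => by
    have h1 := hst p.1 p.2
    have h2 := hst p.2 p.1
    by_cases h3 : p.1 ∈ s <;> by_cases h4 : p.1 ∈ t <;> by_cases h5 : p.2 ∈ s <;>
      by_cases h6 : p.2 ∈ t <;> simp_all [shiftedIndicator]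

variable [IsProbabilityMeasure P]

lemma ConcaveRelation.riskMeasure_add_le {n : ℕ} (hn : 2 ≤ n) (hh : IsDistortion h)
    (H : ConcaveRelation P (fun _ : Fin n => h) h) (hX : MemLp X ⊤ P) (hY : MemLp Y ⊤ P) :
    riskMeasure P h (fun ω => X ω + Y ω) ≤ riskMeasure P h X + riskMeasure P h Y := by
  have h1 := (H (fun ω => X ω + Y ω) (hX.add hY)).2.2
  rw [← EReal.coe_le_coe_iff, h1]
  exact infAggregate_le (twoAgents_mem_allocations hn hX hY)
    (sum_twoAgents hn (riskMeasure P h) (riskMeasure_zero hh)).le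

lemma DualRelation.riskMeasure_add_le {n : ℕ} (hn : 2 ≤ n) (hh : IsDistortion h)
    (H : DualRelation P (fun _ : Fin n => h) h) (hX : MemLp X ⊤ P) (hY : MemLp Y ⊤ P)
    (hXY : CounterMonotonic P X Y) :
    riskMeasure P h (fun ω => X ω + Y ω) ≤ riskMeasure P h X + riskMeasure P h Y := by
  obtain ⟨h1, h2, -⟩ := H (fun ω => X ω + Y ω) (hX.add hY)
  rw [← EReal.coe_le_coe_iff, ← h2, ← h1]
  exact infAggregate_le (twoAgents_mem_counterMonotonicAllocations hn hX hY hXY)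
    (sum_twoAgents hn (riskMeasure P h) (riskMeasure_zero hh)).le

lemma memLp_shiftedIndicator (hs : MeasurableSet s) : MemLp (shiftedIndicator a s) ⊤ P :=
  (memLp_const a).add ((memLp_const (1 : ℝ)).indicator hs)

lemma riskMeasure_shiftedIndicator (hh : IsDistortion h) (ha : a ≤ 0) (ha' : 0 ≤ a + 1) :
    riskMeasure P h (shiftedIndicator a s) = a + h (P.real s) := by
  classical
  have h1 := riskMeasure_affine_nat (P := P) hh (N := 1) (Z := fun ω => if ω ∈ s then 1 else 0)
    (fun ω => by split_ifs <;> omega) one_pos ha (by simpa using ha')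
  have h2 : {ω | 1 ≤ if ω ∈ s then 1 else 0} = s := by
    ext ω
    by_cases hω : ω ∈ s <;> simp [hω]
  simp only [natChoquet, Finset.sum_range_one, zero_add, h2, one_mul, distorted] at h1
  rw [← h1]
  congr 1
  funext ω
  by_cases hω : ω ∈ s <;> simp [shiftedIndicator, hω]

lemma riskMeasure_shiftedIndicator_add (hh : IsDistortion h) (ha : a ≤ 0) (ha' : 0 ≤ a + 1) :
    riskMeasure P h (fun ω => shiftedIndicator a s ω + shiftedIndicator a t ω) =
      2 * a + h (P.real (s ∪ t)) + h (P.real (s ∩ t)) := by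
  classical
  have h1 := riskMeasure_affine_nat (P := P) hh (N := 2) (a := 2 * a)
    (Z := fun ω => (if ω ∈ s then 1 else 0) + if ω ∈ t then 1 else 0)
    (fun ω => by split_ifs <;> omega) one_pos (by linarith) (by push_cast; linarith)
  have h2 : {ω | 1 ≤ (if ω ∈ s then 1 else 0) + if ω ∈ t then 1 else 0} = s ∪ t := by
    ext ω
    by_cases hω : ω ∈ s <;> by_cases hω' : ω ∈ t <;> simp [hω, hω']
  have h3 : {ω | 2 ≤ (if ω ∈ s then 1 else 0) + if ω ∈ t then 1 else 0} = s ∩ t := by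
    ext ω
    by_cases hω : ω ∈ s <;> by_cases hω' : ω ∈ t <;> simp [hω, hω']
  simp only [natChoquet, Finset.sum_range_succ, Finset.sum_range_zero, zero_add,
    Nat.reduceAdd, h2, h3, one_mul, distorted] at h1
  rw [add_assoc, ← h1]
  congr 1
  funext ω
  by_cases hω : ω ∈ s <;> by_cases hω' : ω ∈ t <;> simp [shiftedIndicator, hω, hω'] <;> ring

/-- In an atomless probability space there are disjoint events with given probabilities. -/
lemma Atomless.exists_disjoint (hP : Atomless P) {A : Set Ω} (hA : MeasurableSet A) {y : ℝ}
    (hy : 0 ≤ y) (hAy : P.real A + y ≤ 1) :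
    ∃ B, MeasurableSet B ∧ Disjoint A B ∧ P.real B = y := by
  obtain ⟨B, hB, hBA, hBy⟩ := hP.exists_subset_measureReal_eq hA.compl hy
    (by rw [probReal_compl_eq_one_sub hA]; linarith)
  exact ⟨B, hB, (disjoint_compl_right (a := A)).mono_right hBA, hBy⟩

lemma Atomless.exists_measureReal_eq (hP : Atomless P) {x : ℝ} (hx : x ∈ Icc (0 : ℝ) 1) :
    ∃ A, MeasurableSet A ∧ P.real A = x := by
  obtain ⟨A, hA, -, hAx⟩ := hP.exists_disjoint MeasurableSet.empty hx.1 (by simpa using hx.2)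
  exact ⟨A, hA, hAx⟩

/-- A distortion risk measure that is subadditive comes from a concave distortion. -/
lemma concaveOn_of_riskMeasure_add_le (hP : Atomless P) (hh : IsDistortion h)
    (H : ∀ X Y : Ω → ℝ, MemLp X ⊤ P → MemLp Y ⊤ P →
      riskMeasure P h (fun ω => X ω + Y ω) ≤ riskMeasure P h X + riskMeasure P h Y) :
    ConcaveOn ℝ (Icc 0 1) h := by
  refine concaveOn_of_increments_antitone hh.mono fun x y z hx hy hz hxyz => ?_
  obtain ⟨A, hA, hAx⟩ := hP.exists_measureReal_eq (x := x) ⟨hx, by linarith⟩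
  obtain ⟨B, hB, hAB, hBy⟩ := hP.exists_disjoint hA hy (by linarith)
  have hABr : P.real (A ∪ B) = x + y := by rw [measureReal_union hAB hB, hAx, hBy]
  obtain ⟨D, hD, hABD, hDz⟩ := hP.exists_disjoint (hA.union hB) hz (by linarith)
  have hAD : Disjoint A D := hABD.mono_left subset_union_left
  have hADr : P.real (A ∪ D) = x + z := by rw [measureReal_union hAD hD, hAx, hDz]
  have hU : P.real (A ∪ B ∪ (A ∪ D)) = x + y + z := by
    rw [← union_union_distrib_left, ← union_assoc, measureReal_union hABD hD, hABr, hDz]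
  have hI : P.real ((A ∪ B) ∩ (A ∪ D)) = x := by
    rw [← union_inter_distrib_left,
      (disjoint_iff_inter_eq_empty.1 (hABD.mono_left subset_union_right)), union_empty, hAx]
  -- With `A`, `B`, `D` disjoint of probabilities `x`, `y`, `z`, the indicators of `A ∪ B` and `A ∪
  -- D` yield exactly the decreasing-increments inequality.
  have := H _ _ (memLp_shiftedIndicator (a := 0) (hA.union hB))
    (memLp_shiftedIndicator (a := 0) (hA.union hD))
  rw [riskMeasure_shiftedIndicator_add hh le_rfl (by norm_num),
    riskMeasure_shiftedIndicator hh le_rfl (by norm_num),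
    riskMeasure_shiftedIndicator hh le_rfl (by norm_num), hU, hI, hABr, hADr] at this
  linarith

/-- A distortion risk measure that is subadditive on counter-monotonic variables comes from a
dually subadditive distortion. -/
lemma duallySubadditive_of_riskMeasure_add_le (hP : Atomless P) (hh : IsDistortion h)
    (H : ∀ X Y : Ω → ℝ, MemLp X ⊤ P → MemLp Y ⊤ P → CounterMonotonic P X Y →
      riskMeasure P h (fun ω => X ω + Y ω) ≤ riskMeasure P h X + riskMeasure P h Y) :
    DuallySubadditive h := by
  have key : ∀ x ∈ Icc (0 : ℝ) 1, ∀ y ∈ Icc (0 : ℝ) 1, x + y ≤ 1 →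
      h (x + y) ≤ h x + h y ∧ dual h x + dual h y ≤ dual h (x + y) := by
    intro x hx y hy hxy
    obtain ⟨A, hA, hAx⟩ := hP.exists_measureReal_eq hx
    obtain ⟨B, hB, hAB, hBy⟩ := hP.exists_disjoint hA hy.1 (by linarith)
    have hU : P.real (A ∪ B) = x + y := by rw [measureReal_union hAB hB, hAx, hBy]
    have hI : A ∩ B = ∅ := disjoint_iff_inter_eq_empty.1 hAB
    constructor
    · have := H _ _ (memLp_shiftedIndicator (a := 0) hA) (memLp_shiftedIndicator (a := 0) hB)
        (counterMonotonic_shiftedIndicator fun ω _ h1 h2 => absurd h2 (disjoint_left.1 hAB h1))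
      rw [riskMeasure_shiftedIndicator_add hh le_rfl (by norm_num),
        riskMeasure_shiftedIndicator hh le_rfl (by norm_num),
        riskMeasure_shiftedIndicator hh le_rfl (by norm_num), hU, hI, measureReal_empty,
        hh.map_zero, hAx, hBy] at this
      linarith
    -- The test variables are `-1_A` and `-1_B`; the complements of the disjoint events cover the
    -- space, so the pair is counter-monotonic.
    · have := H _ _ (memLp_shiftedIndicator (a := -1) hA.compl)
        (memLp_shiftedIndicator (a := -1) hB.compl)
        (counterMonotonic_shiftedIndicator fun _ ω _ _ => by
          rw [← mem_union, ← compl_inter, hI, compl_empty]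
          trivial)
      rw [riskMeasure_shiftedIndicator_add hh (by norm_num) (by norm_num),
        riskMeasure_shiftedIndicator hh (by norm_num) (by norm_num),
        riskMeasure_shiftedIndicator hh (by norm_num) (by norm_num), ← compl_inter,
        ← compl_union, hI, compl_empty, probReal_univ, probReal_compl_eq_one_sub (hA.union hB),
        probReal_compl_eq_one_sub hA, probReal_compl_eq_one_sub hB, hU, hAx, hBy,
        hh.map_one] at this
      simp only [dual, hh.map_one]
      linarith
  exact ⟨fun x hx y hy hxy => (key x hx y hy hxy).1, fun x hx y hy hxy => (key x hx y hy hxy).2⟩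

end Converse

end RiskSharing

end

/-! ### Assembly of the theorem. -/

open RiskSharing in
theorem theorem1 {Ω : Type*} [MeasurableSpace Ω] (P : Measure Ω) [IsProbabilityMeasure P]
    (hP : Atomless P) (n : ℕ) (hn : 1 ≤ n) :
    -- (i)
    (∀ f : Fin n → ℝ → ℝ, (∀ i, IsDistortion (f i)) → DuallySubadditive (minDistortion f) →
      ∀ X : Ω → ℝ, MemLp X ⊤ P →
        comonotonicInfConv P f X ≤ counterMonotonicInfConv P f X ∧
        comonotonicInfConv P f X = (riskMeasure P (minDistortion f) X : EReal) ∧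
        infConv P f X ≤ (riskMeasure P (minDistortion f) X : EReal)) ∧
    -- (ii)
    (∀ f : Fin n → ℝ → ℝ, (∀ i, IsDistortion (f i)) → DuallySubadditive (minDistortion f) →
      (∃ j, EqOn (f j) (minDistortion f) (Icc 0 1)) →
      DualRelation P f (minDistortion f)) ∧
    -- (iii), from concavity to the relation
    (∀ f : Fin n → ℝ → ℝ, (∀ i, IsDistortion (f i)) →
      ConcaveOn ℝ (Icc 0 1) (minDistortion f) → ConcaveRelation P f (minDistortion f)) ∧
    -- (iii), as an equivalence
    (2 ≤ n → ∀ h : ℝ → ℝ, IsDistortion h →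
      (ConcaveOn ℝ (Icc 0 1) h ↔
        ∀ f : Fin n → ℝ → ℝ, (∀ i, IsDistortion (f i)) → EqOn (minDistortion f) h (Icc 0 1) →
          ConcaveRelation P f h) ∧
      (ConcaveOn ℝ (Icc 0 1) h ↔ ConcaveRelation P (fun _ : Fin n => h) h)) ∧
    -- (iv)
    (2 ≤ n → ∀ h : ℝ → ℝ, IsDistortion h →
      DualRelation P (fun _ : Fin n => h) h → DuallySubadditive h) := by
  have hconst : ∀ h : ℝ → ℝ, EqOn (minDistortion fun _ : Fin n => h) h (Icc 0 1) := fun h t _ =>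
    have : Nonempty (Fin n) := ⟨⟨0, hn⟩⟩
    ciInf_const
  have hforward : ∀ h : ℝ → ℝ, ConcaveOn ℝ (Icc 0 1) h → ∀ f : Fin n → ℝ → ℝ,
      (∀ i, IsDistortion (f i)) → EqOn (minDistortion f) h (Icc 0 1) → ConcaveRelation P f h := by
    intro h hc f hf heq X hX
    rw [← riskMeasure_congr_distortion heq]
    exact concaveRelation_minDistortion hn hf (hc.congr heq.symm) X hX
  -- The constant family alone forces concavity; both equivalences in (iii) close through it.
  have hbackward : 2 ≤ n → ∀ h : ℝ → ℝ, IsDistortion h →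
      ConcaveRelation P (fun _ : Fin n => h) h → ConcaveOn ℝ (Icc 0 1) h := fun hn2 h hh H =>
    concaveOn_of_riskMeasure_add_le hP hh fun X Y hX hY => H.riskMeasure_add_le hn2 hh hX hY
  refine ⟨fun f hf hd X hX => ?_, fun f hf hd ⟨j, hj⟩ X hX => ?_,
    fun f hf hc => concaveRelation_minDistortion hn hf hc, fun hn2 h hh => ⟨⟨hforward h, fun H =>
      hbackward hn2 h hh (H _ (fun _ => hh) (hconst h))⟩, fun hc =>
        hforward h hc _ (fun _ => hh) (hconst h), hbackward hn2 h hh⟩, fun hn2 h hh H =>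
    duallySubadditive_of_riskMeasure_add_le hP hh fun X Y hX hY hXY =>
      H.riskMeasure_add_le hn2 hh hX hY hXY⟩
  · have h1 := comonotonicInfConv_eq hn hf hX
    exact ⟨h1.trans_le (le_counterMonotonicInfConv hn hf hd X), h1, infConv_le_riskMeasure hn hf hX⟩
  · have h1 := comonotonicInfConv_eq hn hf hX
    refine ⟨?_, h1, infConv_le_riskMeasure hn hf hX⟩
    rw [h1]
    exact (counterMonotonicInfConv_le hf hj hX).antisymm (le_counterMonotonicInfConv hn hf hd X)
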